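/- **Setting.** Let $\mu_1,\mu_2,\beta\in\mathbb R$, $\sigma_1,\sigma_2>0$, and let $\boldsymbol X=(x_1,\dots,x_N)$ be $N$ independent observations of the pair $(X_1,X_2)$, where $X_1\sim\mathcal N(\mu_1,\sigma_1^2)$ and $X_2\mid X_1=x\sim\mathcal N(\mu_2+\beta x,\sigma_2^2)$. Two graphs are compared: $\mathcal G_1$, i.e. $X_1\to X_2$, and $\mathcal G_0$, with no edge. They have prior probabilities $P(\mathcal G_1),P(\mathcal G_0)>0$ with sum $1$, and $P(\mathcal G\mid\boldsymbol X)\propto P(\boldsymbol X\mid\mathcal G)P(\mathcal G)$, where $P(\boldsymbol X\mid\mathcal G)$ is the marginal likelihood. *BGe score.* Under $\mathcal G_1$ the observations are modelled as independent bivariate normal vectors with mean $\mu$ and precision matrix $W$. The prior is Normal-Wishart: $W\sim\mathcal W_2(T^{-1},\alpha_w)$ with density proportional to $|W|^{(\alpha_w-3)/2}\exp\{-\frac12\operatorname{Tr}(TW)\}$ on positive definite matrices, $T=tI_2$, $t>0$, $\alpha_w>3$, and $\mu\mid W\sim\mathcal N(0,(\alpha_\mu W)^{-1})$, $\alpha_\mu>0$.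 Under $\mathcal G_0$ the two variables are modelled as independent normal variables; their parameters (mean and variance) are independent of each other, each pair having the marginal prior $(\mu_i,(W^{-1})_{ii})$ induced by the Normal-Wishart prior. Put $$r_{10}=\frac1N\,\mathbb E\left[\log\frac{P(\mathcal G_1\mid\boldsymbol X)}{P(\mathcal G_0\mid\boldsymbol X)}\right],$$ the expectation being over the law of the data $\boldsymbol X$. *BDe score.* Let $\boldsymbol X'$ be the binary data obtained by replacing each value of $X_i$ by $1$ if it is at least the median $c_i$ of the distribution of $X_i$, and by $0$ otherwise. The cell probabilities of $(X_1',X_2')$, in the order $(1,1),(1,0),(0,1),(0,0)$, have a Dirichlet prior with parameters $\alpha_1,\dots,\alpha_4>0$. Under $\mathcal G_1$ the parameters $P(X_1'=1)$, $P(X_2'=1\mid X_1'=1)$, $P(X_2'=1\mid X_1'=0)$ have the prior induced by this Dirichlet distribution. Under $\mathcal G_0$ the two variables are independent, and the parameters $P(X_1'=1)$ and $P(X_2'=1)$ are independent, each with the marginal prior induced by the Dirichlet distribution. Put $$\tilde r_{10}=\frac1N\sum_{\boldsymbol x'}\log\left(\frac{P(\mathcal G_1\mid\boldsymbol X'=\boldsymbol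 x')}{P(\mathcal G_0\mid\boldsymbol X'=\boldsymbol x')}\right)P(\boldsymbol X'=\boldsymbol x'),$$ the sum being over all $\boldsymbol x'\in(\{0,1\}^2)^N$. **Theorem.** For all parameters as above: (RAG) the expectation defining $r_{10}$ exists (the log ratio is integrable for every $N$) and $$\lim_{N\to\infty}r_{10}=\frac12\log\left(\frac{\sigma_2^2+\beta^2\sigma_1^2}{\sigma_2^2}\right);$$ (DISC) $$\lim_{N\to\infty}\tilde r_{10}=\log 4+2\tilde p_{11}\log\tilde p_{11}+(1-2\tilde p_{11})\log\left(\tfrac12-\tilde p_{11}\right),$$ where $\tilde p_{11}=\int_0^\infty\frac1{\sqrt{2\pi}}e^{-x^2/2}\,\Phi\left(\frac{\sigma_1\beta x}{\sigma_2}\right)dx$ and $\Phi$ is the cumulative distribution function of the standard normal distribution. -/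

import Mathlib

open MeasureTheory ProbabilityTheory Filter Topology
open scoped NNReal ENNReal

noncomputable section

namespace TwoNodeBN

/-! ### Candidate graphs and posterior probabilities -/

/-- The two candidate structures on the nodes `X₁, X₂` (up to equivalence):
`indep` has no edge, `edge` is `X₁ → X₂`. -/
inductive Graph where
  | indep
  | edge

/-- Bayes' rule on the two candidate structures: `P(G ∣ X) ∝ P(X ∣ G) P(G)`, where `lik G` is the
marginal likelihood of the observed data. -/
def posterior (prior lik : Graph → ℝ) (G : Graph) : ℝ :=
  lik G * prior G / (lik .indep * prior .indep + lik .edge * prior .edge)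

/-- The log posterior ratio of `edge` against `indep`. -/
def logPosteriorRatio (prior lik : Graph → ℝ) : ℝ :=
  Real.log (posterior prior lik .edge / posterior prior lik .indep)

/-! ### BGe: Gaussian likelihood with a Normal-Wishart prior -/

/-- The multivariate gamma function `Γₙ(a)`. -/
def multivariateGamma (n : ℕ) (a : ℝ) : ℝ :=
  Real.pi ^ ((n : ℝ) * (n - 1) / 4) * ∏ j ∈ Finset.Icc 1 n, Real.Gamma (a + (1 - (j : ℝ)) / 2)

open Classical in
/-- Density of the Wishart distribution `𝒲ₙ(T⁻¹, a)` with `a` degrees of freedom, with respect to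
Lebesgue measure on the upper-triangular entries of the symmetric matrix `W`. -/
def wishartPDF {n : ℕ} (T : Matrix (Fin n) (Fin n) ℝ) (a : ℝ) (W : Matrix (Fin n) (Fin n) ℝ) : ℝ :=
  if W.PosDef then
    W.det ^ ((a - n - 1) / 2) /
        (2 ^ (a * n / 2) * multivariateGamma n (a / 2) / T.det ^ (a / 2)) *
      Real.exp (-(1 / 2) * (T * W).trace)
  else 0

/-- Density at `x` of the normal distribution on `ℝⁿ` with mean `m` and precision matrix `W`. -/
def normalPDF {n : ℕ} (m : Fin n → ℝ) (W : Matrix (Fin n) (Fin n) ℝ) (x : Fin n → ℝ) : ℝ :=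
  Real.sqrt W.det / (2 * Real.pi) ^ ((n : ℝ) / 2) *
    Real.exp (-(1 / 2) * ((x - m) ⬝ᵥ W.mulVec (x - m)))

/-- The symmetric `2 × 2` matrix with upper-triangular entries `w₁₁, w₁₂, w₂₂`. -/
def symMatrix (w : ℝ × ℝ × ℝ) : Matrix (Fin 2) (Fin 2) ℝ :=
  !![w.1, w.2.1; w.2.1, w.2.2]

/-- The Normal-Wishart prior on the parameters `(μ, W)` of a bivariate normal distribution:
`W ∼ 𝒲₂(T⁻¹, αw)` and `μ ∣ W` is normal with mean `ν` and precision matrix `αμ W`. -/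
def normalWishart (ν : Fin 2 → ℝ) (T : Matrix (Fin 2) (Fin 2) ℝ) (αμ αw : ℝ) :
    Measure ((Fin 2 → ℝ) × (ℝ × ℝ × ℝ)) :=
  volume.withDensity fun p =>
    ENNReal.ofReal (wishartPDF T αw (symMatrix p.2) * normalPDF ν (αμ • symMatrix p.2) p.1)

/-- The prior that `normalWishart` induces on the mean and variance of the single variable `Xᵢ`. -/
def normalWishartMarginal (ν : Fin 2 → ℝ) (T : Matrix (Fin 2) (Fin 2) ℝ) (αμ αw : ℝ) (i : Fin 2) :
    Measure (ℝ × ℝ≥0) :=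
  (normalWishart ν T αμ αw).map fun p => (p.1 i, Real.toNNReal ((symMatrix p.2)⁻¹ i i))

/-- The BGe marginal likelihood of `N` observations. With the edge, the model is an unrestricted
bivariate normal distribution. Without it, the two variables are independent normals, whose
parameters are independent and have the same marginal priors as before. -/
def bgeLikelihood (ν : Fin 2 → ℝ) (T : Matrix (Fin 2) (Fin 2) ℝ) (αμ αw : ℝ) {N : ℕ}
    (x : Fin N → ℝ × ℝ) : Graph → ℝ
  | .edge => ∫ p, ∏ j, normalPDF p.1 (symMatrix p.2) ![(x j).1, (x j).2]
      ∂(normalWishart ν T αμ αw)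
  | .indep => ∫ p, ∏ j, gaussianPDFReal p.1.1 p.1.2 (x j).1 * gaussianPDFReal p.2.1 p.2.2 (x j).2
      ∂((normalWishartMarginal ν T αμ αw 0).prod (normalWishartMarginal ν T αμ αw 1))

/-! ### BDe: binary data with a Dirichlet prior -/

/-- The multivariate beta function. -/
def multivariateBeta {K : ℕ} (a : Fin K → ℝ) : ℝ :=
  (∏ i, Real.Gamma (a i)) / Real.Gamma (∑ i, a i)

/-- Density of the Dirichlet distribution on the cell probabilities
`θ = (P(X₁=1, X₂=1), P(X₁=1, X₂=0), P(X₁=0, X₂=1))` of two binary variables. -/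
def dirichletPDF (a : Fin 4 → ℝ) (θ : ℝ × ℝ × ℝ) : ℝ :=
  if 0 < θ.1 ∧ 0 < θ.2.1 ∧ 0 < θ.2.2 ∧ θ.1 + θ.2.1 + θ.2.2 < 1 then
    1 / multivariateBeta a * θ.1 ^ (a 0 - 1) * θ.2.1 ^ (a 1 - 1) * θ.2.2 ^ (a 2 - 1) *
      (1 - θ.1 - θ.2.1 - θ.2.2) ^ (a 3 - 1)
  else 0

/-- The Dirichlet prior on the cell probabilities. -/
def dirichlet (a : Fin 4 → ℝ) : Measure (ℝ × ℝ × ℝ) :=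
  volume.withDensity fun θ => ENNReal.ofReal (dirichletPDF a θ)

/-- The prior that `dirichlet` induces on the parameters
`(P(X₁=1), P(X₂=1 ∣ X₁=1), P(X₂=1 ∣ X₁=0))` of the graph `X₁ → X₂`. -/
def dirichletEdge (a : Fin 4 → ℝ) : Measure (ℝ × ℝ × ℝ) :=
  (dirichlet a).map fun θ =>
    (θ.1 + θ.2.1, θ.1 / (θ.1 + θ.2.1), θ.2.2 / (1 - (θ.1 + θ.2.1)))

/-- The prior that `dirichlet` induces on `P(X₁=1)`. -/
def dirichletFst (a : Fin 4 → ℝ) : Measure ℝ := (dirichlet a).map fun θ => θ.1 + θ.2.1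

/-- The prior that `dirichlet` induces on `P(X₂=1)`. -/
def dirichletSnd (a : Fin 4 → ℝ) : Measure ℝ := (dirichlet a).map fun θ => θ.1 + θ.2.2

/-- Probability of the outcome `b` of a Bernoulli variable with success probability `p`
(`true` stands for `1`). -/
def bernoulliMass (p : ℝ) (b : Bool) : ℝ := if b then p else 1 - p

/-- The BDe marginal likelihood of `N` binary observations. Without the edge, the parameters
`P(X₁=1)` and `P(X₂=1)` are independent and have the same marginal priors as before. -/
def bdeLikelihood (a : Fin 4 → ℝ) {N : ℕ} (x : Fin N → Bool × Bool) : Graph → ℝ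
  | .edge => ∫ θ, ∏ j, bernoulliMass θ.1 (x j).1 *
      bernoulliMass (if (x j).1 then θ.2.1 else θ.2.2) (x j).2 ∂(dirichletEdge a)
  | .indep => ∫ θ, ∏ j, bernoulliMass θ.1 (x j).1 * bernoulliMass θ.2 (x j).2
      ∂((dirichletFst a).prod (dirichletSnd a))

/-! ### The data -/

/-- The conditional law of `X₂` given `X₁ = x₁`, namely `𝒩(μ₂ + β x₁, σ₂²)`. -/
def linearGaussianKernel (μ₂ β σ₂ : ℝ) : Kernel ℝ ℝ where
  toFun x₁ := gaussianReal (μ₂ + β * x₁) (Real.toNNReal (σ₂ ^ 2))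
  measurable' := by
    have h : Measurable fun x₁ : ℝ => (μ₂ + β * x₁, Real.toNNReal (σ₂ ^ 2)) := by fun_prop
    exact measurable_gaussianReal.comp h

instance (μ₂ β σ₂ : ℝ) : IsMarkovKernel (linearGaussianKernel μ₂ β σ₂) :=
  ⟨fun x₁ => by
    change IsProbabilityMeasure (gaussianReal (μ₂ + β * x₁) (Real.toNNReal (σ₂ ^ 2)))
    infer_instance⟩

/-- The joint law of `(X₁, X₂)` when `X₁ ∼ 𝒩(μ₁, σ₁²)` and `X₂ ∣ X₁ = x₁ ∼ 𝒩(μ₂ + β x₁, σ₂²)`. -/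
def linearGaussian (μ₁ μ₂ β σ₁ σ₂ : ℝ) : Measure (ℝ × ℝ) :=
  (gaussianReal μ₁ (Real.toNNReal (σ₁ ^ 2))) ⊗ₘ linearGaussianKernel μ₂ β σ₂

instance (μ₁ μ₂ β σ₁ σ₂ : ℝ) : IsProbabilityMeasure (linearGaussian μ₁ μ₂ β σ₁ σ₂) := by
  unfold linearGaussian; infer_instance

/-- The law of `N` independent observations with common law `P`. -/
def sampleLaw {E : Type*} [MeasurableSpace E] (P : Measure E) (N : ℕ) : Measure (Fin N → E) :=
  Measure.pi fun _ => P

/-- `c` is a median of the law `P`. -/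
def IsMedian (P : Measure ℝ) (c : ℝ) : Prop :=
  1 / 2 ≤ P (Set.Iic c) ∧ 1 / 2 ≤ P (Set.Ici c)

/-- Discretization of a pair of real numbers with cutting points `c₁, c₂`. -/
def discretize (c₁ c₂ : ℝ) (x : ℝ × ℝ) : Bool × Bool := (decide (c₁ ≤ x.1), decide (c₂ ≤ x.2))

/-! ### The evaluation criteria -/

/-- The log posterior ratio of a continuous data set under the BGe score. -/
def bgeLogRatio (prior : Graph → ℝ) (ν : Fin 2 → ℝ) (T : Matrix (Fin 2) (Fin 2) ℝ) (αμ αw : ℝ)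
    {N : ℕ} (x : Fin N → ℝ × ℝ) : ℝ :=
  logPosteriorRatio prior (bgeLikelihood ν T αμ αw x)

/-- `r₁₀`: the expected log posterior ratio per sample under the BGe score, for `N` independent
observations with law `P`. -/
def expectedRatioBGe (prior : Graph → ℝ) (ν : Fin 2 → ℝ) (T : Matrix (Fin 2) (Fin 2) ℝ)
    (αμ αw : ℝ) (P : Measure (ℝ × ℝ)) (N : ℕ) : ℝ :=
  1 / (N : ℝ) * ∫ x, bgeLogRatio prior ν T αμ αw x ∂(sampleLaw P N)

/-- `r̃₁₀`: the expected log posterior ratio per sample under the BDe score, for the data set that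
arises from `N` independent observations with law `P` by discretization at `c₁, c₂`. -/
def expectedRatioBDe (prior : Graph → ℝ) (a : Fin 4 → ℝ) (c₁ c₂ : ℝ) (P : Measure (ℝ × ℝ))
    (N : ℕ) : ℝ :=
  1 / (N : ℝ) * ∑ x' : Fin N → Bool × Bool,
    logPosteriorRatio prior (bdeLikelihood a x') *
      (sampleLaw P N).real {x | (fun j => discretize c₁ c₂ (x j)) = x'}

/-- `p̃₁₁ = ∫₀^∞ φ(x) Φ(σ₁ β x / σ₂) dx`. -/
def pTilde (β σ₁ σ₂ : ℝ) : ℝ :=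
  ∫ x in Set.Ioi (0 : ℝ), 1 / Real.sqrt (2 * Real.pi) * Real.exp (-(x ^ 2 / 2)) *
    cdf (gaussianReal 0 1) (σ₁ * β * x / σ₂)

end TwoNodeBN

end

/-! Both limits are the mutual information of the pair, for the original and for the discretized
law, and both follow from one fact about Bayesian marginal likelihoods. Let a model `f` with finite
prior `π` contain the density `p` of the data law `P`, and let `R` be the integral over `π` of the
likelihood ratio of the sample against `p`. Then the expectation of `log R` is `o(N)`.

Upper bound: each parameter's ratio `f θ / p` has mean at most one, so by independence and Fubini
the mean of `R` is at most the total mass of `π`, and `log R ≤ R`. Lower bound: near the true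
parameter `f θ ≥ p * exp (-ε G)` with `G` integrable, on a set `U` of positive prior mass, so `log R
≥ log π(U) - ε ∑ G`; then `ε` is arbitrary. No Laplace expansion and no closed form of a score is
needed, and the prior enters only through its finite mass and its positivity near the truth. This is
`tendsto_log_marginal`.

Applied to the joint model and to the two single-node models, it gives the limit `E log p - E log p₁
- E log p₂` (`tendsto_integral_logPosteriorRatio`); the prior odds vanish after division by `N`. The
remaining work is to check `Regular` and to evaluate three expectations. For binary data `Regular`
is continuity at the true cell probabilities. For normal data it comes from the exponential family
form (`eventually_exp_mul_le`), with `G` one plus the squared norm. In the normal case the entropies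
leave half the log ratio of the variance of `X₂` to `σ₂ ^ 2`. In the binary case a median is the
mean, so both margins are fair coins and every cell is determined by the quadrant probability
`pTilde`. -/

namespace BayesMixture

/-! ### Growth rate of the expected log marginal likelihood -/

variable {Θ E : Type*} [MeasurableSpace Θ] [MeasurableSpace E]

/-- A statistical model with nonnegative, jointly measurable likelihood `f`, a prior `π` and data
law `P`, compared with a positive function `p`: the likelihood ratio `f θ / p` has expectation at
most one, and near some parameters in the support of `π` it is bounded below by `exp (-ε G)`. -/
structure Regular (P : Measure E) (π : Measure Θ) (f : Θ → E → ℝ) (p : E → ℝ) : Prop where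
  measurable_lik : Measurable fun z : Θ × E => f z.1 z.2
  measurable_ref : Measurable p
  ref_pos : ∀ x, 0 < p x
  integrable_log : Integrable (fun x => Real.log (p x)) P
  nonneg : ∀ᵐ θ ∂π, ∀ x, 0 ≤ f θ x
  integrable_ratio : ∀ᵐ θ ∂π, Integrable (fun x => f θ x / p x) P
  integral_ratio_le : ∀ᵐ θ ∂π, ∫ x, f θ x / p x ∂P ≤ 1
  exists_lower : ∃ G : E → ℝ, Integrable G P ∧ ∀ ε : ℝ, 0 < ε →
    ∃ U : Set Θ, MeasurableSet U ∧ π U ≠ 0 ∧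
      ∀ θ ∈ U, ∀ x, p x * Real.exp (-(ε * G x)) ≤ f θ x

/-- The marginal likelihood of a sample. -/
noncomputable def marginal (π : Measure Θ) (f : Θ → E → ℝ) {N : ℕ} (x : Fin N → E) : ℝ :=
  ∫ θ, ∏ j, f θ (x j) ∂π

/-- The marginal likelihood ratio of a sample. -/
noncomputable def ratio (π : Measure Θ) (f : Θ → E → ℝ) (p : E → ℝ) {N : ℕ} (x : Fin N → E) : ℝ :=
  ∫ θ, ∏ j, (f θ (x j) / p (x j)) ∂π

section

variable {P : Measure E} {π : Measure Θ} {f : Θ → E → ℝ} {p : E → ℝ}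

lemma marginal_eq_mul_ratio (h : Regular P π f p) {N : ℕ} (x : Fin N → E) :
    marginal π f x = (∏ j, p (x j)) * ratio π f p x := by
  rw [marginal, ratio, ← integral_const_mul]
  congr 1 with θ
  rw [← Finset.prod_mul_distrib]
  refine Finset.prod_congr rfl fun j _ => ?_
  rw [mul_div_cancel₀ _ (h.ref_pos _).ne']

variable [IsProbabilityMeasure P] [IsFiniteMeasure π]

/-- Integrating over the sample first, independence turns the product into the `N`-th power of a
number in `[0, 1]`, and a bounded function is integrable against a finite prior. This justifies
every later use of Fubini. -/
lemma integrable_prod_ratio (h : Regular P π f p) (N : ℕ) :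
    Integrable (fun z : (Fin N → E) × Θ => ∏ j, (f z.2 (z.1 j) / p (z.1 j)))
      ((Measure.pi fun _ : Fin N => P).prod π) := by
  have hm : Measurable (fun z : (Fin N → E) × Θ => ∏ j, (f z.2 (z.1 j) / p (z.1 j))) := by
    refine Finset.measurable_prod _ fun j _ => ?_
    have h1 : Measurable fun z : (Fin N → E) × Θ => (z.2, z.1 j) := by fun_prop
    exact (h.measurable_lik.comp h1).div (h.measurable_ref.comp (by fun_prop))
  refine (integrable_prod_iff' hm.aestronglyMeasurable).2 ⟨?_, ?_⟩
  · filter_upwards [h.integrable_ratio] with θ hθ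
    exact Integrable.fintype_prod (f := fun (_ : Fin N) x => f θ x / p x) fun _ => hθ
  · refine (integrable_const (1 : ℝ)).mono' ?_ ?_
    · exact (hm.norm.stronglyMeasurable.integral_prod_left').aestronglyMeasurable
    · filter_upwards [h.nonneg, h.integral_ratio_le] with θ h0 h1
      have h2 : ∀ x : Fin N → E, ‖∏ j, (f θ (x j) / p (x j))‖ = ∏ j, (f θ (x j) / p (x j)) :=
        fun x => Real.norm_of_nonneg
          (Finset.prod_nonneg fun j _ => div_nonneg (h0 _) (h.ref_pos _).le)
      simp_rw [h2]
      rw [integral_fintype_prod_eq_pow (ι := Fin N) (fun x => f θ x / p x)]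
      have h3 : 0 ≤ ∫ x, f θ x / p x ∂P :=
        integral_nonneg fun x => div_nonneg (h0 _) (h.ref_pos _).le
      rw [Real.norm_of_nonneg (pow_nonneg h3 _)]
      exact pow_le_one₀ h3 h1

lemma integrable_ratio (h : Regular P π f p) (N : ℕ) :
    Integrable (fun x : Fin N → E => ratio π f p x) (Measure.pi fun _ => P) :=
  (integrable_prod_ratio h N).integral_prod_left

lemma integral_ratio_le (h : Regular P π f p) (N : ℕ) :
    ∫ x : Fin N → E, ratio π f p x ∂(Measure.pi fun _ => P) ≤ π.real Set.univ := by
  have := integral_integral_swap (f := fun (x : Fin N → E) θ => ∏ j, (f θ (x j) / p (x j)))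
    (integrable_prod_ratio h N)
  simp only [ratio]
  rw [this]
  have h1 : π.real Set.univ = ∫ _, (1 : ℝ) ∂π := by simp
  rw [h1]
  refine integral_mono_ae (integrable_prod_ratio h N).integral_prod_right (integrable_const _) ?_
  filter_upwards [h.nonneg, h.integral_ratio_le] with θ h0 h1
  rw [integral_fintype_prod_eq_pow (ι := Fin N) (fun x => f θ x / p x)]
  exact pow_le_one₀ (integral_nonneg fun x => div_nonneg (h0 _) (h.ref_pos _).le) h1

/-- Discarding the parameters outside `U` only decreases the integral of a nonnegative function. The
bound is almost sure because it needs integrability in `θ` for the given sample. -/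
lemma lower_le_ratio (h : Regular P π f p) {G : E → ℝ} {ε : ℝ} {U : Set Θ}
    (hU : MeasurableSet U)
    (hl : ∀ θ ∈ U, ∀ x, p x * Real.exp (-(ε * G x)) ≤ f θ x) (N : ℕ) :
    ∀ᵐ x : Fin N → E ∂(Measure.pi fun _ => P),
      π.real U * Real.exp (-(ε * ∑ j, G (x j))) ≤ ratio π f p x := by
  filter_upwards [(integrable_prod_ratio h N).prod_right_ae] with x hx
  have h1 : ∫ θ in U, Real.exp (-(ε * ∑ j, G (x j))) ∂π
      ≤ ∫ θ in U, ∏ j, (f θ (x j) / p (x j)) ∂π := by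
    refine setIntegral_mono_on (integrable_const _).integrableOn hx.integrableOn hU ?_
    intro θ hθ
    rw [Finset.mul_sum, ← Finset.sum_neg_distrib, Real.exp_sum]
    refine Finset.prod_le_prod (fun j _ => (Real.exp_pos _).le) fun j _ => ?_
    rw [le_div_iff₀ (h.ref_pos _), mul_comm]
    exact hl θ hθ _
  rw [setIntegral_const, smul_eq_mul] at h1
  refine h1.trans (setIntegral_le_integral hx ?_)
  filter_upwards [h.nonneg] with θ h0
  exact Finset.prod_nonneg fun j _ => div_nonneg (h0 _) (h.ref_pos _).le

lemma ratio_pos (h : Regular P π f p) (N : ℕ) :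
    ∀ᵐ x : Fin N → E ∂(Measure.pi fun _ => P), 0 < ratio π f p x := by
  obtain ⟨G, -, hG⟩ := h.exists_lower
  obtain ⟨U, hU, hU0, hl⟩ := hG 1 one_pos
  filter_upwards [lower_le_ratio h hU hl N] with x hx
  have : 0 < π.real U := ENNReal.toReal_pos hU0 (measure_ne_top _ _)
  exact lt_of_lt_of_le (by positivity) hx

lemma marginal_pos (h : Regular P π f p) (N : ℕ) :
    ∀ᵐ x : Fin N → E ∂(Measure.pi fun _ => P), 0 < marginal π f x := by
  filter_upwards [ratio_pos h N] with x hx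
  rw [marginal_eq_mul_ratio h]
  exact mul_pos (Finset.prod_pos fun j _ => h.ref_pos _) hx

lemma log_lower_le (h : Regular P π f p) {G : E → ℝ} {ε : ℝ} {U : Set Θ}
    (hU : MeasurableSet U) (hU0 : π U ≠ 0)
    (hl : ∀ θ ∈ U, ∀ x, p x * Real.exp (-(ε * G x)) ≤ f θ x) (N : ℕ) :
    ∀ᵐ x : Fin N → E ∂(Measure.pi fun _ => P),
      Real.log (π.real U) - ε * ∑ j, G (x j) ≤ Real.log (ratio π f p x) := by
  filter_upwards [lower_le_ratio h hU hl N] with x hx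
  have : 0 < π.real U := ENNReal.toReal_pos hU0 (measure_ne_top _ _)
  have h2 := Real.log_le_log (by positivity) hx
  rwa [Real.log_mul this.ne' (Real.exp_pos _).ne', Real.log_exp, ← sub_eq_add_neg] at h2

lemma integrable_sum_eval {g : E → ℝ} (hg : Integrable g P) (N : ℕ) :
    Integrable (fun x : Fin N → E => ∑ j, g (x j)) (Measure.pi fun _ => P) :=
  integrable_finsetSum _ fun j _ => integrable_comp_eval (μ := fun _ : Fin N => P) (i := j) hg

lemma integral_sum_eval {g : E → ℝ} (hg : Integrable g P) (N : ℕ) :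
    ∫ x : Fin N → E, ∑ j, g (x j) ∂(Measure.pi fun _ => P) = N * ∫ x, g x ∂P := by
  rw [integral_finsetSum _ fun j _ =>
    integrable_comp_eval (μ := fun _ : Fin N => P) (i := j) hg]
  simp_rw [fun j : Fin N => integral_comp_eval (μ := fun _ : Fin N => P) (i := j)
    hg.aestronglyMeasurable]
  simp

/-- The logarithm lies between the integrable lower bound with `ε = 1` and the integrable ratio
itself. -/
lemma integrable_log_ratio (h : Regular P π f p) (N : ℕ) :
    Integrable (fun x : Fin N → E => Real.log (ratio π f p x)) (Measure.pi fun _ => P) := by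
  obtain ⟨G, hGi, hG⟩ := h.exists_lower
  obtain ⟨U, hU, hU0, hl⟩ := hG 1 one_pos
  have hi := integrable_ratio h N
  refine Integrable.mono' (g := fun x => ‖Real.log (π.real U) - 1 * ∑ j, G (x j)‖
      + ‖ratio π f p x‖) ?_ ?_ ?_
  · exact ((integrable_const _).sub ((integrable_sum_eval hGi N).const_mul 1)).norm.add hi.norm
  · exact (Real.measurable_log.comp_aemeasurable hi.aemeasurable).aestronglyMeasurable
  · filter_upwards [log_lower_le h hU hU0 hl N, ratio_pos h N] with x h1 h2
    have h3 := Real.log_le_sub_one_of_pos h2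
    simp only [Real.norm_eq_abs]
    rw [abs_le]
    constructor
    · have := neg_abs_le (Real.log (π.real U) - 1 * ∑ j, G (x j))
      have := abs_nonneg (ratio π f p x)
      linarith
    · have := abs_nonneg (Real.log (π.real U) - 1 * ∑ j, G (x j))
      have := le_abs_self (ratio π f p x)
      linarith

lemma log_marginal_ae_eq (h : Regular P π f p) (N : ℕ) :
    (fun x : Fin N → E => Real.log (marginal π f x)) =ᵐ[Measure.pi fun _ => P]
      fun x => ∑ j, Real.log (p (x j)) + Real.log (ratio π f p x) := by
  filter_upwards [ratio_pos h N] with x hx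
  rw [marginal_eq_mul_ratio h, Real.log_mul (Finset.prod_pos fun j _ => h.ref_pos _).ne' hx.ne',
    Real.log_prod fun j _ => (h.ref_pos _).ne']

lemma integrable_log_marginal (h : Regular P π f p) (N : ℕ) :
    Integrable (fun x : Fin N → E => Real.log (marginal π f x)) (Measure.pi fun _ => P) :=
  ((integrable_sum_eval h.integrable_log N).add (integrable_log_ratio h N)).congr
    (log_marginal_ae_eq h N).symm

lemma integral_log_marginal (h : Regular P π f p) (N : ℕ) :
    ∫ x : Fin N → E, Real.log (marginal π f x) ∂(Measure.pi fun _ => P)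
      = N * ∫ x, Real.log (p x) ∂P
        + ∫ x : Fin N → E, Real.log (ratio π f p x) ∂(Measure.pi fun _ => P) := by
  rw [integral_congr_ae (log_marginal_ae_eq h N),
    integral_add (integrable_sum_eval h.integrable_log N) (integrable_log_ratio h N),
    integral_sum_eval h.integrable_log]

lemma tendsto_log_ratio (h : Regular P π f p) :
    Tendsto (fun N : ℕ => 1 / (N : ℝ) *
      ∫ x : Fin N → E, Real.log (ratio π f p x) ∂(Measure.pi fun _ => P)) atTop (𝓝 0) := by
  obtain ⟨G, hGi, hG⟩ := h.exists_lower
  rw [Metric.tendsto_nhds]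
  intro δ hδ
  set g := ∫ x, G x ∂P with hg
  -- Chosen so that the term linear in `N` costs at most `δ / 2` per observation; the `+ 1` covers
  -- `g = 0`.
  set ε := δ / (2 * (|g| + 1)) with hε
  have hεpos : 0 < ε := by positivity
  obtain ⟨U, hU, hU0, hl⟩ := hG ε hεpos
  have hεg : ε * g ≤ δ / 2 := by
    have h1 : ε * (|g| + 1) = δ / 2 := by rw [hε]; field_simp
    nlinarith [le_abs_self g]
  -- `A` bounds the errors of both directions that do not grow with `N`; the other `δ / 2` pays for
  -- `A / N`.
  set A := |Real.log (π.real U)| + π.real Set.univ with hA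
  have hlim : Tendsto (fun N : ℕ => A / (N : ℝ)) atTop (𝓝 0) :=
    tendsto_const_div_atTop_nhds_zero_nat A
  filter_upwards [hlim.eventually (gt_mem_nhds (half_pos hδ)), eventually_gt_atTop 0] with N hN hN0
  have hNpos : (0 : ℝ) < N := by exact_mod_cast hN0
  set I := ∫ x : Fin N → E, Real.log (ratio π f p x) ∂(Measure.pi fun _ => P) with hI
  have hup : I ≤ π.real Set.univ := by
    refine le_trans ?_ (integral_ratio_le h N)
    refine integral_mono_ae (integrable_log_ratio h N) (integrable_ratio h N) ?_
    filter_upwards [ratio_pos h N] with x hx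
    have := Real.log_le_sub_one_of_pos hx
    linarith
  have hlo : Real.log (π.real U) - ε * (N * g) ≤ I := by
    have h1 := integral_mono_ae
      ((integrable_const _).sub ((integrable_sum_eval hGi N).const_mul ε))
      (integrable_log_ratio h N) (log_lower_le h hU hU0 hl N)
    simp only [Pi.sub_apply] at h1
    rw [integral_sub (integrable_const _) ((integrable_sum_eval hGi N).const_mul ε),
      integral_const_mul, integral_sum_eval hGi] at h1
    simpa using h1
  have hπ : 0 ≤ π.real Set.univ := measureReal_nonneg
  rw [div_lt_iff₀ hNpos] at hN
  rw [Real.dist_eq, sub_zero, abs_lt]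
  have hlog := neg_abs_le (Real.log (π.real U))
  have hlog' := abs_nonneg (Real.log (π.real U))
  have hNg := mul_le_mul_of_nonneg_left hεg hNpos.le
  rw [one_div, inv_mul_eq_div, lt_div_iff₀ hNpos, div_lt_iff₀ hNpos]
  constructor <;> nlinarith

/-- The expected log marginal likelihood per observation tends to `E log p`. -/
theorem tendsto_log_marginal (h : Regular P π f p) :
    Tendsto (fun N : ℕ => 1 / (N : ℝ) *
      ∫ x : Fin N → E, Real.log (marginal π f x) ∂(Measure.pi fun _ => P)) atTop
      (𝓝 (∫ x, Real.log (p x) ∂P)) := by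
  have h1 := (tendsto_log_ratio h).const_add (∫ x, Real.log (p x) ∂P)
  rw [add_zero] at h1
  refine h1.congr' ?_
  filter_upwards [eventually_gt_atTop 0] with N hN0
  have hNpos : (0 : ℝ) < N := by exact_mod_cast hN0
  rw [integral_log_marginal h]
  field_simp

end

/-- The likelihood ratio with respect to a density of the data law. -/
lemma integrable_div_density {l : Measure E} {p g : E → ℝ} (hp : Measurable p)
    (hpos : ∀ x, 0 < p x) (hg : Measurable g) (hg0 : ∀ x, 0 ≤ g x)
    (hg1 : ∫⁻ x, ENNReal.ofReal (g x) ∂l ≤ 1) :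
    Integrable (fun x => g x / p x) (l.withDensity fun x => ENNReal.ofReal (p x)) ∧
      ∫ x, g x / p x ∂(l.withDensity fun x => ENNReal.ofReal (p x)) ≤ 1 := by
  have hnn : ∀ x, 0 ≤ g x / p x := fun x => div_nonneg (hg0 x) (hpos x).le
  have h1 : ∫⁻ x, ENNReal.ofReal (g x / p x) ∂(l.withDensity fun x => ENNReal.ofReal (p x))
      = ∫⁻ x, ENNReal.ofReal (g x) ∂l := by
    rw [lintegral_withDensity_eq_lintegral_mul _ hp.ennreal_ofReal (hg.fun_div hp).ennreal_ofReal]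
    refine lintegral_congr fun x => ?_
    rw [Pi.mul_apply, ← ENNReal.ofReal_mul (hpos x).le, mul_div_cancel₀ _ (hpos x).ne']
  have hm : AEStronglyMeasurable (fun x => g x / p x)
      (l.withDensity fun x => ENNReal.ofReal (p x)) := (hg.div hp).aestronglyMeasurable
  refine ⟨⟨hm, ?_⟩, ?_⟩
  · rw [hasFiniteIntegral_iff_ofReal (Eventually.of_forall hnn), h1]
    exact lt_of_le_of_lt hg1 ENNReal.one_lt_top
  · rw [integral_eq_lintegral_of_nonneg_ae (Eventually.of_forall hnn) hm, h1]
    exact ENNReal.toReal_le_of_le_ofReal zero_le_one (by simpa using hg1)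

end BayesMixture

/-! ### From marginal likelihoods to the posterior ratio of two graphs -/

namespace BayesMixture

open TwoNodeBN

section

variable {X : Type*} [TopologicalSpace X] [MeasurableSpace X] [OpensMeasurableSpace X]

/-- A neighbourhood of a point where the density is positive contains a measurable set that is not
null. -/
lemma exists_measurableSet_withDensity_ne_zero (l : Measure X) [l.IsOpenPosMeasure]
    {d : X → ℝ≥0∞} (hd : Measurable d) {x₀ : X} (hpos : ∀ᶠ x in 𝓝 x₀, 0 < d x)
    {Q : X → Prop} (hQ : ∀ᶠ x in 𝓝 x₀, Q x) :
    ∃ U, MeasurableSet U ∧ (l.withDensity d) U ≠ 0 ∧ ∀ x ∈ U, Q x := by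
  obtain ⟨U, hU, hUo, hxU⟩ := eventually_nhds_iff.1 (hpos.and hQ)
  refine ⟨U, hUo.measurableSet, ?_, fun x hx => (hU x hx).2⟩
  rw [Ne, withDensity_apply_eq_zero hd]
  have h1 : {x | d x ≠ 0} ∩ U = U := Set.inter_eq_right.2 fun x hx => (hU x hx).1.ne'
  rw [h1]
  exact hUo.measure_ne_zero l ⟨x₀, hxU⟩

end

/-- On a finite sample space the local lower bound amounts to finitely many inequalities, strict at
`θ₀` and hence true nearby by continuity, so `G = 1` suffices. -/
lemma regular_of_fintype {Θ E : Type*} [TopologicalSpace Θ] [MeasurableSpace Θ]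
    [OpensMeasurableSpace Θ] [Fintype E] [MeasurableSpace E] [MeasurableSingletonClass E]
    (P : Measure E) [IsProbabilityMeasure P] (hP : ∀ x, 0 < P.real {x})
    (l : Measure Θ) [l.IsOpenPosMeasure] {d : Θ → ℝ≥0∞} (hd : Measurable d)
    {f : Θ → E → ℝ} (hf : ∀ x, Measurable fun θ => f θ x)
    (hnn : ∀ᵐ θ ∂(l.withDensity d), ∀ x, 0 ≤ f θ x)
    (hsum : ∀ᵐ θ ∂(l.withDensity d), ∑ x, f θ x ≤ 1)
    {θ₀ : Θ} (hpos : ∀ᶠ θ in 𝓝 θ₀, 0 < d θ) (hcont : ∀ x, ContinuousAt (fun θ => f θ x) θ₀)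
    (hθ₀ : ∀ x, f θ₀ x = P.real {x}) :
    Regular P (l.withDensity d) f fun x => P.real {x} where
  measurable_lik := measurable_from_prod_countable_left hf
  measurable_ref := measurable_of_finite _
  ref_pos := hP
  integrable_log := .of_finite
  nonneg := hnn
  integrable_ratio := Eventually.of_forall fun θ => .of_finite
  integral_ratio_le := by
    filter_upwards [hsum] with θ hθ
    rw [integral_fintype .of_finite]
    refine le_trans (le_of_eq (Finset.sum_congr rfl fun x _ => ?_)) hθ
    rw [smul_eq_mul, mul_div_cancel₀ _ (hP x).ne']
  exists_lower := by
    refine ⟨fun _ => 1, integrable_const _, fun ε hε =>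
      exists_measurableSet_withDensity_ne_zero l hd hpos (eventually_all.2 fun x => ?_)⟩
    have h1 : P.real {x} * Real.exp (-(ε * 1)) < f θ₀ x := by
      rw [hθ₀]
      have : Real.exp (-(ε * 1)) < 1 := by simpa using hε
      nlinarith [hP x]
    exact ((hcont x).eventually (lt_mem_nhds h1)).mono fun _ h => h.le

section

variable {E₁ E₂ Θ Θ₁ Θ₂ : Type*} [MeasurableSpace E₁] [MeasurableSpace E₂] [MeasurableSpace Θ]
  [MeasurableSpace Θ₁] [MeasurableSpace Θ₂] {P : Measure (E₁ × E₂)} [IsProbabilityMeasure P]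
  {π : Measure Θ} [IsFiniteMeasure π] {π₁ : Measure Θ₁} [IsFiniteMeasure π₁]
  {π₂ : Measure Θ₂} [IsFiniteMeasure π₂]
  {f : Θ → E₁ × E₂ → ℝ} {f₁ : Θ₁ → E₁ → ℝ} {f₂ : Θ₂ → E₂ → ℝ}
  {p : E₁ × E₂ → ℝ} {p₁ : E₁ → ℝ} {p₂ : E₂ → ℝ}

/-- The normalizing constant of Bayes' rule cancels in the ratio. -/
lemma logPosteriorRatio_eq {prior lik : Graph → ℝ} (hprior : ∀ G, 0 < prior G)
    (hlik : ∀ G, 0 < lik G) :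
    logPosteriorRatio prior lik = Real.log (prior .edge / prior .indep)
      + (Real.log (lik .edge) - Real.log (lik .indep)) := by
  have h1 := hprior .edge
  have h2 := hprior .indep
  have h3 := hlik .edge
  have h4 := hlik .indep
  unfold logPosteriorRatio TwoNodeBN.posterior
  rw [div_div_div_cancel_right₀ (by positivity),
    Real.log_div (by positivity) (by positivity), Real.log_mul h3.ne' h1.ne',
    Real.log_mul h4.ne' h2.ne', Real.log_div h1.ne' h2.ne']
  ring

lemma measurePreserving_pi_map {F : Type*} [MeasurableSpace F] {g : E₁ × E₂ → F}
    (hg : Measurable g) (N : ℕ) :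
    MeasurePreserving (fun (x : Fin N → E₁ × E₂) j => g (x j)) (Measure.pi fun _ => P)
      (Measure.pi fun _ => P.map g) := by
  have := Measure.isProbabilityMeasure_map (μ := P) hg.aemeasurable
  exact ⟨by fun_prop, Measure.pi_map_pi (μ := fun _ : Fin N => P) fun _ => hg.aemeasurable⟩

variable (h : Regular P π f p) (h₁ : Regular (P.map Prod.fst) π₁ f₁ p₁)
  (h₂ : Regular (P.map Prod.snd) π₂ f₂ p₂)
  {prior : Graph → ℝ} (hprior : ∀ G, 0 < prior G)
  {lik : (N : ℕ) → (Fin N → E₁ × E₂) → Graph → ℝ}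
  (hedge : ∀ N x, lik N x .edge = marginal π f x)
  (hindep : ∀ N x, lik N x .indep
    = marginal π₁ f₁ (fun j => (x j).1) * marginal π₂ f₂ (fun j => (x j).2))

include h h₁ h₂ hprior hedge hindep in
lemma logPosteriorRatio_ae_eq (N : ℕ) :
    (fun x => logPosteriorRatio prior (lik N x)) =ᵐ[Measure.pi fun _ => P]
      fun x => Real.log (prior .edge / prior .indep) + (Real.log (marginal π f x)
        - (Real.log (marginal π₁ f₁ fun j => (x j).1)
          + Real.log (marginal π₂ f₂ fun j => (x j).2))) := by
  have := Measure.isProbabilityMeasure_map (μ := P) measurable_fst.aemeasurable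
  have := Measure.isProbabilityMeasure_map (μ := P) measurable_snd.aemeasurable
  filter_upwards [marginal_pos h N,
    (measurePreserving_pi_map (P := P) measurable_fst N).quasiMeasurePreserving.ae
      (marginal_pos h₁ N),
    (measurePreserving_pi_map (P := P) measurable_snd N).quasiMeasurePreserving.ae
      (marginal_pos h₂ N)] with x hx hx₁ hx₂
  rw [logPosteriorRatio_eq hprior, hedge, hindep, Real.log_mul hx₁.ne' hx₂.ne']
  rintro (_ | _)
  · rw [hindep]; exact mul_pos hx₁ hx₂
  · rw [hedge]; exact hx

include h h₁ h₂ hprior hedge hindep in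
lemma integrable_logPosteriorRatio (N : ℕ) :
    Integrable (fun x => logPosteriorRatio prior (lik N x)) (Measure.pi fun _ => P) := by
  have := Measure.isProbabilityMeasure_map (μ := P) measurable_fst.aemeasurable
  have := Measure.isProbabilityMeasure_map (μ := P) measurable_snd.aemeasurable
  refine Integrable.congr ?_
    (logPosteriorRatio_ae_eq h h₁ h₂ hprior hedge hindep N).symm
  exact (integrable_const _).add ((integrable_log_marginal h N).sub
    (((measurePreserving_pi_map measurable_fst N).integrable_comp_of_integrable
      (integrable_log_marginal h₁ N)).add
    ((measurePreserving_pi_map measurable_snd N).integrable_comp_of_integrable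
      (integrable_log_marginal h₂ N))))

include h h₁ h₂ hprior hedge hindep in
-- The log ratio splits into three log marginal likelihoods, each with a known rate; the samples of
-- the single variables are again independent, with the marginal laws of `P`. When `p`, `p₁`, `p₂`
-- are the densities of these laws, the limit is the mutual information.
theorem tendsto_integral_logPosteriorRatio :
    Tendsto (fun N : ℕ => 1 / (N : ℝ) *
        ∫ x, logPosteriorRatio prior (lik N x) ∂(Measure.pi fun _ => P)) atTop
      (𝓝 (∫ x, Real.log (p x) ∂P - (∫ x, Real.log (p₁ x) ∂(P.map Prod.fst)
        + ∫ x, Real.log (p₂ x) ∂(P.map Prod.snd)))) := by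
  have := Measure.isProbabilityMeasure_map (μ := P) measurable_fst.aemeasurable
  have := Measure.isProbabilityMeasure_map (μ := P) measurable_snd.aemeasurable
  have hc := tendsto_const_div_atTop_nhds_zero_nat (Real.log (prior .edge / prior .indep))
  have key := hc.add ((tendsto_log_marginal h).sub
    ((tendsto_log_marginal h₁).add (tendsto_log_marginal h₂)))
  rw [zero_add] at key
  refine key.congr fun N => ?_
  have m₁ := measurePreserving_pi_map (P := P) measurable_fst N
  have m₂ := measurePreserving_pi_map (P := P) measurable_snd N
  have i₁ := m₁.integrable_comp_of_integrable (integrable_log_marginal h₁ N)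
  have i₂ := m₂.integrable_comp_of_integrable (integrable_log_marginal h₂ N)
  have e₁ : ∫ x : Fin N → E₁ × E₂, Real.log (marginal π₁ f₁ fun j => (x j).1)
      ∂(Measure.pi fun _ => P)
      = ∫ y : Fin N → E₁, Real.log (marginal π₁ f₁ y) ∂(Measure.pi fun _ => P.map Prod.fst) := by
    rw [← m₁.map_eq, integral_map m₁.measurable.aemeasurable]
    rw [m₁.map_eq]
    exact (integrable_log_marginal h₁ N).aestronglyMeasurable
  have e₂ : ∫ x : Fin N → E₁ × E₂, Real.log (marginal π₂ f₂ fun j => (x j).2)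
      ∂(Measure.pi fun _ => P)
      = ∫ y : Fin N → E₂, Real.log (marginal π₂ f₂ y) ∂(Measure.pi fun _ => P.map Prod.snd) := by
    rw [← m₂.map_eq, integral_map m₂.measurable.aemeasurable]
    rw [m₂.map_eq]
    exact (integrable_log_marginal h₂ N).aestronglyMeasurable
  rw [integral_congr_ae (logPosteriorRatio_ae_eq h h₁ h₂ hprior hedge hindep N),
    integral_add (integrable_const _), integral_sub (integrable_log_marginal h N),
    integral_add, e₁, e₂]
  · simp
    ring
  · exact i₁
  · exact i₂
  · exact i₁.add i₂
  · exact (integrable_log_marginal h N).sub (i₁.add i₂)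

end

end BayesMixture

namespace TwoNodeBN

open BayesMixture

/-! ### The Dirichlet prior -/

/-- The substitution `x = s * u` reduces the integral to the normalized beta density. -/
lemma lintegral_beta_scaled {a b s : ℝ} (ha : 0 < a) (hb : 0 < b) (hs : 0 < s) :
    ∫⁻ x, ENNReal.ofReal (if 0 < x ∧ x < s then x ^ (a - 1) * (s - x) ^ (b - 1) else 0)
      = ENNReal.ofReal (beta a b * s ^ (a + b - 1)) := by
  have hB := beta_pos ha hb
  have hm : Measurable fun x : ℝ =>
      ENNReal.ofReal (if 0 < x ∧ x < s then x ^ (a - 1) * (s - x) ^ (b - 1) else 0) := by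
    refine Measurable.ennreal_ofReal (Measurable.ite measurableSet_Ioo (by fun_prop) (by fun_prop))
  rw [← Real.smul_map_volume_mul_left hs.ne', lintegral_smul_measure,
    lintegral_map hm (by fun_prop)]
  have h1 : ∀ x : ℝ, ENNReal.ofReal (if 0 < s * x ∧ s * x < s then
      (s * x) ^ (a - 1) * (s - s * x) ^ (b - 1) else 0)
      = ENNReal.ofReal (s ^ (a + b - 2) * beta a b) * betaPDF a b x := by
    intro x
    rw [betaPDF_eq, ← ENNReal.ofReal_mul (by positivity)]
    congr 1
    have e1 : (0 < s * x ∧ s * x < s) ↔ (0 < x ∧ x < 1) := by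
      rw [mul_pos_iff_of_pos_left hs, mul_lt_iff_lt_one_right hs]
    simp only [e1]
    split_ifs with hx
    · have h2 : s - s * x = s * (1 - x) := by ring
      rw [h2, Real.mul_rpow hs.le hx.1.le, Real.mul_rpow hs.le (by linarith),
        show a + b - 2 = (a - 1) + (b - 1) by ring, Real.rpow_add hs]
      field_simp
    · simp
  simp_rw [h1]
  rw [lintegral_const_mul' _ _ ENNReal.ofReal_ne_top, lintegral_betaPDF_eq_one ha hb, mul_one,
    smul_eq_mul, abs_of_pos hs, ← ENNReal.ofReal_mul hs.le]
  congr 1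
  rw [show a + b - 1 = 1 + (a + b - 2) by ring, Real.rpow_add hs, Real.rpow_one]
  ring

/-- The open simplex of cell probabilities. -/
def IsCellProb (θ : ℝ × ℝ × ℝ) : Prop :=
  0 < θ.1 ∧ 0 < θ.2.1 ∧ 0 < θ.2.2 ∧ θ.1 + θ.2.1 + θ.2.2 < 1

lemma isOpen_isCellProb : IsOpen {θ | IsCellProb θ} := by
  simp only [IsCellProb, Set.ofPred_and]
  refine (isOpen_lt ?_ ?_).inter ((isOpen_lt ?_ ?_).inter ((isOpen_lt ?_ ?_).inter
    (isOpen_lt ?_ ?_))) <;> fun_prop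

lemma measurable_dirichletPDF (a : Fin 4 → ℝ) : Measurable (dirichletPDF a) := by
  unfold dirichletPDF
  exact Measurable.ite isOpen_isCellProb.measurableSet (by fun_prop) (by fun_prop)

lemma multivariateBeta_pos {K : ℕ} [NeZero K] {a : Fin K → ℝ} (ha : ∀ i, 0 < a i) :
    0 < multivariateBeta a :=
  div_pos (Finset.prod_pos fun i _ => Real.Gamma_pos_of_pos (ha i))
    (Real.Gamma_pos_of_pos (Finset.sum_pos (fun i _ => ha i) Finset.univ_nonempty))

/-- Stick breaking: each successive integration is a scaled beta integral, and leaves a power of the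
remaining length for the next one. Only finiteness is needed, so the product of the constants is
never compared with one. -/
lemma lintegral_dirichletPDF_lt_top {a : Fin 4 → ℝ} (ha : ∀ i, 0 < a i) :
    ∫⁻ θ, ENNReal.ofReal (dirichletPDF a θ) < ∞ := by
  have hm := (measurable_dirichletPDF a).ennreal_ofReal
  rw [Measure.volume_eq_prod, lintegral_prod _ hm.aemeasurable]
  set c := 1 / multivariateBeta a with hc
  have hc0 : 0 < c := one_div_pos.2 (multivariateBeta_pos ha)
  have a0 := ha 0
  have a1 := ha 1
  have a2 := ha 2
  have a3 := ha 3
  have b1 := beta_pos a2 a3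
  have b2 := beta_pos a1 (add_pos a2 a3)
  have h1 : ∀ x y : ℝ, ∫⁻ z, ENNReal.ofReal (dirichletPDF a (x, y, z))
      = ENNReal.ofReal (if 0 < x then c * x ^ (a 0 - 1) * beta (a 2) (a 3) else 0)
        * ENNReal.ofReal (if 0 < y ∧ y < 1 - x then
          y ^ (a 1 - 1) * (1 - x - y) ^ (a 2 + a 3 - 1) else 0) := by
    intro x y
    by_cases hx : 0 < x
    swap
    · simp [dirichletPDF, hx]
    by_cases hy : 0 < y ∧ y < 1 - x
    swap
    · have : ∀ z, dirichletPDF a (x, y, z) = 0 := fun z =>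
        if_neg fun h => hy ⟨h.2.1, by have := h.2.2.1; have := h.2.2.2; simp at *; linarith⟩
      simp [this, hy]
    rw [if_pos hx, if_pos hy, ← ENNReal.ofReal_mul (by positivity)]
    have hy0 := hy.1
    have e : ∀ z, ENNReal.ofReal (dirichletPDF a (x, y, z))
        = ENNReal.ofReal (c * x ^ (a 0 - 1) * y ^ (a 1 - 1))
          * ENNReal.ofReal (if 0 < z ∧ z < 1 - x - y then
            z ^ (a 2 - 1) * (1 - x - y - z) ^ (a 3 - 1) else 0) := by
      intro z
      rw [← ENNReal.ofReal_mul (by positivity)]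
      congr 1
      unfold dirichletPDF
      by_cases hz : 0 < z ∧ z < 1 - x - y
      · rw [if_pos hz, if_pos ⟨hx, hy0, hz.1, by simp only; linarith [hz.2]⟩]
        ring
      · rw [if_neg hz, if_neg fun h => hz ⟨h.2.2.1, by have := h.2.2.2; simp only at this; linarith⟩]
        ring
    simp_rw [e]
    rw [lintegral_const_mul' _ _ ENNReal.ofReal_ne_top,
      lintegral_beta_scaled a2 a3 (by linarith [hy.2]), ← ENNReal.ofReal_mul (by positivity)]
    congr 1
    ring
  have h2 : ∀ x : ℝ, ∫⁻ w : ℝ × ℝ, ENNReal.ofReal (dirichletPDF a (x, w))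
      = ENNReal.ofReal (c * beta (a 2) (a 3) * beta (a 1) (a 2 + a 3))
        * ENNReal.ofReal (if 0 < x ∧ x < 1 then
          x ^ (a 0 - 1) * (1 - x) ^ (a 1 + (a 2 + a 3) - 1) else 0) := by
    intro x
    have hmx : Measurable fun w : ℝ × ℝ => ENNReal.ofReal (dirichletPDF a (x, w)) :=
      hm.comp measurable_prodMk_left
    rw [Measure.volume_eq_prod, lintegral_prod _ hmx.aemeasurable]
    simp_rw [h1]
    rw [lintegral_const_mul' _ _ ENNReal.ofReal_ne_top]
    by_cases hx : 0 < x ∧ x < 1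
    swap
    · rw [if_neg hx, ENNReal.ofReal_zero, mul_zero, mul_eq_zero]
      by_cases hx0 : 0 < x
      · right
        have : ∀ y, ¬(0 < y ∧ y < 1 - x) := fun y h => hx ⟨hx0, by linarith [h.1, h.2]⟩
        simp [this]
      · left; simp [hx0]
    have hx0 := hx.1
    rw [if_pos hx, if_pos hx0, lintegral_beta_scaled a1 (add_pos a2 a3) (by linarith [hx.2]),
      ← ENNReal.ofReal_mul (by positivity), ← ENNReal.ofReal_mul (by positivity)]
    congr 1
    ring
  simp_rw [h2]
  rw [lintegral_const_mul' _ _ ENNReal.ofReal_ne_top,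
    lintegral_beta_scaled a0 (add_pos a1 (add_pos a2 a3)) one_pos]
  exact ENNReal.mul_lt_top ENNReal.ofReal_lt_top ENNReal.ofReal_lt_top

lemma isFiniteMeasure_dirichlet {a : Fin 4 → ℝ} (ha : ∀ i, 0 < a i) :
    IsFiniteMeasure (dirichlet a) :=
  isFiniteMeasure_withDensity (lintegral_dirichletPDF_lt_top ha).ne

lemma ae_dirichlet_isCellProb (a : Fin 4 → ℝ) : ∀ᵐ θ ∂(dirichlet a), IsCellProb θ := by
  rw [dirichlet, ae_withDensity_iff (measurable_dirichletPDF a).ennreal_ofReal]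
  refine Eventually.of_forall fun θ hθ => ?_
  by_contra h
  exact hθ (by rw [show dirichletPDF a θ = 0 from if_neg h, ENNReal.ofReal_zero])

lemma eventually_dirichletPDF_pos {a : Fin 4 → ℝ} (ha : ∀ i, 0 < a i) {θ₀ : ℝ × ℝ × ℝ}
    (h : IsCellProb θ₀) : ∀ᶠ θ in 𝓝 θ₀, 0 < ENNReal.ofReal (dirichletPDF a θ) := by
  filter_upwards [isOpen_isCellProb.mem_nhds h] with θ hθ
  rw [ENNReal.ofReal_pos]
  refine lt_of_lt_of_eq ?_ (if_pos hθ).symm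
  have := multivariateBeta_pos ha
  obtain ⟨k1, k2, k3, k4⟩ := hθ
  have k5 : 0 < 1 - θ.1 - θ.2.1 - θ.2.2 := by linarith
  positivity

/-! ### The discrete likelihoods -/

/-- The probability of an outcome of two binary variables with given cell probabilities. -/
def cellMass (θ : ℝ × ℝ × ℝ) : Bool × Bool → ℝ
  | (true, true) => θ.1
  | (true, false) => θ.2.1
  | (false, true) => θ.2.2
  | (false, false) => 1 - θ.1 - θ.2.1 - θ.2.2

lemma continuous_cellMass (b : Bool × Bool) : Continuous fun θ => cellMass θ b := by
  obtain ⟨_ | _, _ | _⟩ := b <;> simp only [cellMass] <;> fun_prop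

lemma continuous_bernoulliMass (b : Bool) : Continuous fun q => bernoulliMass q b := by
  cases b <;> simp [bernoulliMass] <;> fun_prop

/-- Pulled back to the simplex, a marginal times a conditional probability is a cell probability.
The denominators are nonzero in the open simplex, which carries the prior. -/
lemma bdeLikelihood_edge (a : Fin 4 → ℝ) {N : ℕ} (x : Fin N → Bool × Bool) :
    bdeLikelihood a x .edge = marginal (dirichlet a) cellMass x := by
  rw [bdeLikelihood, dirichletEdge, integral_map, marginal]
  · refine integral_congr_ae ?_
    filter_upwards [ae_dirichlet_isCellProb a] with θ hθ
    refine Finset.prod_congr rfl fun j _ => ?_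
    obtain ⟨k1, k2, k3, k4⟩ := hθ
    have k5 : θ.1 + θ.2.1 ≠ 0 := by positivity
    have k6 : 1 - (θ.1 + θ.2.1) ≠ 0 := by intro h; linarith
    rcases x j with ⟨_ | _, _ | _⟩ <;> simp [cellMass, bernoulliMass] <;> field_simp <;> ring
  · exact Measurable.aemeasurable (by fun_prop)
  · refine (Finset.measurable_prod _ fun j _ => ?_).aestronglyMeasurable
    refine ((continuous_bernoulliMass _).measurable.comp measurable_fst).mul
      ((continuous_bernoulliMass _).measurable.comp ?_)
    cases (x j).1 <;> simp <;> fun_prop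

lemma bdeLikelihood_indep {a : Fin 4 → ℝ} (ha : ∀ i, 0 < a i) {N : ℕ} (x : Fin N → Bool × Bool) :
    bdeLikelihood a x .indep
      = marginal (dirichlet a) (fun θ => bernoulliMass (θ.1 + θ.2.1)) (fun j => (x j).1)
        * marginal (dirichlet a) (fun θ => bernoulliMass (θ.1 + θ.2.2)) (fun j => (x j).2) := by
  have := isFiniteMeasure_dirichlet ha
  have hf : Measurable fun θ : ℝ × ℝ × ℝ => θ.1 + θ.2.1 := by fun_prop
  have hs : Measurable fun θ : ℝ × ℝ × ℝ => θ.1 + θ.2.2 := by fun_prop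
  have hm : ∀ y : Fin N → Bool, Measurable fun q => ∏ j, bernoulliMass q (y j) := fun y =>
    Finset.measurable_prod _ fun j _ => (continuous_bernoulliMass _).measurable
  have : IsFiniteMeasure (dirichletFst a) := Measure.isFiniteMeasure_map _ _
  have : IsFiniteMeasure (dirichletSnd a) := Measure.isFiniteMeasure_map _ _
  simp only [bdeLikelihood, Finset.prod_mul_distrib]
  rw [integral_prod_mul (fun q => ∏ j, bernoulliMass q (x j).1)
    (fun q => ∏ j, bernoulliMass q (x j).2), dirichletFst, dirichletSnd,
    integral_map hf.aemeasurable (hm _).aestronglyMeasurable,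
    integral_map hs.aemeasurable (hm _).aestronglyMeasurable]
  rfl

section

variable {a : Fin 4 → ℝ} (ha : ∀ i, 0 < a i) (P : Measure (Bool × Bool)) [IsProbabilityMeasure P]

/-- The cell probabilities of a law on pairs of binary variables. -/
def cellProb : ℝ × ℝ × ℝ := (P.real {(true, true)}, P.real {(true, false)}, P.real {(false, true)})

lemma sum_cells : P.real {(true, true)} + P.real {(true, false)} + P.real {(false, true)}
    + P.real {(false, false)} = 1 := by
  have h := integral_fintype (μ := P) (f := fun _ => (1 : ℝ)) .of_finite
  simp only [integral_const, probReal_univ, smul_eq_mul, mul_one, Fintype.sum_prod_type,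
    Fintype.sum_bool] at h
  linarith

lemma map_fst_true : (P.map Prod.fst).real {true}
    = P.real {(true, true)} + P.real {(true, false)} := by
  rw [map_measureReal_apply measurable_fst (measurableSet_singleton _),
    ← measureReal_union (by simp) (measurableSet_singleton _)]
  congr 1; ext ⟨_ | _, _ | _⟩ <;> simp

lemma map_snd_true : (P.map Prod.snd).real {true}
    = P.real {(true, true)} + P.real {(false, true)} := by
  rw [map_measureReal_apply measurable_snd (measurableSet_singleton _),
    ← measureReal_union (by simp) (measurableSet_singleton _)]
  congr 1; ext ⟨_ | _, _ | _⟩ <;> simp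

lemma real_false_eq (Q : Measure Bool) [IsProbabilityMeasure Q] :
    Q.real {false} = 1 - Q.real {true} := by
  have h := integral_fintype (μ := Q) (f := fun _ => (1 : ℝ)) .of_finite
  simp only [integral_const, probReal_univ, smul_eq_mul, mul_one, Fintype.sum_bool] at h
  linarith

variable {P} (hP : ∀ b, 0 < P.real {b})

include hP in
lemma isCellProb_cellProb : IsCellProb (cellProb P) :=
  ⟨hP _, hP _, hP _, by have := sum_cells P; have := hP (false, false); simp only [cellProb]; linarith⟩

include ha hP

lemma regular_cellMass : Regular P (dirichlet a) cellMass fun b => P.real {b} := by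
  refine regular_of_fintype P hP volume (measurable_dirichletPDF a).ennreal_ofReal
    (fun b => (continuous_cellMass b).measurable) ?_ ?_
    (eventually_dirichletPDF_pos ha (isCellProb_cellProb hP))
    (fun b => (continuous_cellMass b).continuousAt) ?_
  · refine (ae_dirichlet_isCellProb a).mono fun θ hθ b => ?_
    obtain ⟨k1, k2, k3, k4⟩ := hθ
    obtain ⟨_ | _, _ | _⟩ := b <;> simp only [cellMass] <;> linarith
  · refine Eventually.of_forall fun θ => le_of_eq ?_
    simp only [Fintype.sum_prod_type, Fintype.sum_bool, cellMass]
    ring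
  · have := sum_cells P
    rintro ⟨_ | _, _ | _⟩ <;> simp only [cellMass, cellProb]
    linarith

/-- The single-variable model stays parametrized by the whole simplex, with `s` reading off the
success probability. The induced beta priors therefore never have to be computed, and positivity of
the Dirichlet density at `cellProb P` suffices. -/
lemma regular_bernoulli {s : ℝ × ℝ × ℝ → ℝ} (hs : Continuous s)
    (hs01 : ∀ θ, IsCellProb θ → 0 ≤ s θ ∧ s θ ≤ 1) (Q : Measure Bool) [IsProbabilityMeasure Q]
    (hQ : ∀ b, 0 < Q.real {b}) (hsQ : s (cellProb P) = Q.real {true}) :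
    Regular Q (dirichlet a) (fun θ => bernoulliMass (s θ)) fun b => Q.real {b} := by
  refine regular_of_fintype Q hQ volume (measurable_dirichletPDF a).ennreal_ofReal
    (fun b => ((continuous_bernoulliMass b).comp hs).measurable) ?_ ?_
    (eventually_dirichletPDF_pos ha (isCellProb_cellProb hP))
    (fun b => ((continuous_bernoulliMass b).comp hs).continuousAt) ?_
  · refine (ae_dirichlet_isCellProb a).mono fun θ hθ b => ?_
    have := hs01 θ hθ
    cases b <;> simp [bernoulliMass, this]
  · refine Eventually.of_forall fun θ => le_of_eq ?_
    simp [bernoulliMass]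
  · rintro (_ | _)
    · simp [bernoulliMass, hsQ, real_false_eq]
    · simp [bernoulliMass, hsQ]

end

/-! ### The limit for binary data with fair margins -/

lemma expectedRatioBDe_eq (prior : Graph → ℝ) (a : Fin 4 → ℝ) (c₁ c₂ : ℝ) (P : Measure (ℝ × ℝ))
    [IsProbabilityMeasure P] (hd : Measurable (discretize c₁ c₂)) (N : ℕ) :
    expectedRatioBDe prior a c₁ c₂ P N = 1 / (N : ℝ) *
      ∫ x : Fin N → Bool × Bool, logPosteriorRatio prior (bdeLikelihood a x)
        ∂(Measure.pi fun _ => P.map (discretize c₁ c₂)) := by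
  have := Measure.isProbabilityMeasure_map (μ := P) hd.aemeasurable
  rw [expectedRatioBDe, integral_fintype .of_finite]
  congr 1
  refine Finset.sum_congr rfl fun x' _ => ?_
  have m := measurePreserving_pi_map (P := P) hd N
  rw [← m.map_eq, map_measureReal_apply m.measurable (measurableSet_singleton _), smul_eq_mul,
    mul_comm]
  rfl

/-- The limit of the expected log posterior ratio per sample under the BDe score. -/
theorem tendsto_expectedRatioBDe {prior : Graph → ℝ} (hprior : ∀ G, 0 < prior G)
    {a : Fin 4 → ℝ} (ha : ∀ i, 0 < a i) (c₁ c₂ : ℝ) (P : Measure (ℝ × ℝ))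
    [IsProbabilityMeasure P] (hd : Measurable (discretize c₁ c₂)) {q : ℝ} (hq0 : 0 < q)
    (hq1 : q < 1 / 2) (h11 : (P.map (discretize c₁ c₂)).real {(true, true)} = q)
    (h10 : (P.map (discretize c₁ c₂)).real {(true, false)} = 1 / 2 - q)
    (h01 : (P.map (discretize c₁ c₂)).real {(false, true)} = 1 / 2 - q) :
    Tendsto (expectedRatioBDe prior a c₁ c₂ P) atTop
      (𝓝 (Real.log 4 + 2 * q * Real.log q + (1 - 2 * q) * Real.log (1 / 2 - q))) := by
  rw [funext (expectedRatioBDe_eq prior a c₁ c₂ P hd)]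
  have := Measure.isProbabilityMeasure_map (μ := P) hd.aemeasurable
  set Q := P.map (discretize c₁ c₂) with hQdef
  have := isFiniteMeasure_dirichlet ha
  have := Measure.isProbabilityMeasure_map (μ := Q) measurable_fst.aemeasurable
  have := Measure.isProbabilityMeasure_map (μ := Q) measurable_snd.aemeasurable
  have h00 : Q.real {(false, false)} = q := by have := sum_cells Q; linarith
  have hQ : ∀ b, 0 < Q.real {b} := by
    rintro ⟨_ | _, _ | _⟩ <;> simp only [h11, h10, h01, h00] <;> linarith
  have f1 : (Q.map Prod.fst).real {true} = 1 / 2 := by rw [map_fst_true]; linarith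
  have f2 : (Q.map Prod.snd).real {true} = 1 / 2 := by rw [map_snd_true]; linarith
  have f1' : (Q.map Prod.fst).real {false} = 1 / 2 := by rw [real_false_eq]; linarith
  have f2' : (Q.map Prod.snd).real {false} = 1 / 2 := by rw [real_false_eq]; linarith
  have r := regular_cellMass ha hQ
  have r1 := regular_bernoulli ha hQ (s := fun θ => θ.1 + θ.2.1) (by fun_prop)
    (by rintro θ ⟨k1, k2, k3, k4⟩; constructor <;> linarith) (Q.map Prod.fst)
    (by rintro (_ | _) <;> simp only [f1, f1'] <;> norm_num) (map_fst_true Q).symm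
  have r2 := regular_bernoulli ha hQ (s := fun θ => θ.1 + θ.2.2) (by fun_prop)
    (by rintro θ ⟨k1, k2, k3, k4⟩; constructor <;> linarith) (Q.map Prod.snd)
    (by rintro (_ | _) <;> simp only [f2, f2'] <;> norm_num) (map_snd_true Q).symm
  have key := tendsto_integral_logPosteriorRatio r r1 r2 hprior
    (lik := fun N x => bdeLikelihood a x) (fun N x => bdeLikelihood_edge a x)
    (fun N x => bdeLikelihood_indep ha x)
  convert key using 2
  rw [integral_fintype .of_finite, integral_fintype .of_finite, integral_fintype .of_finite]
  simp only [Fintype.sum_prod_type, Fintype.sum_bool, h11, h10, h01, h00, f1, f1', f2, f2',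
    smul_eq_mul]
  -- Each of the two fair margins contributes `log (1 / 2)`, and both are subtracted.
  have e4 : Real.log 4 = -(2 * Real.log (1 / 2)) := by
    rw [one_div, Real.log_inv, show (4 : ℝ) = 2 ^ 2 by norm_num, Real.log_pow]; push_cast; ring
  rw [e4]; ring

end TwoNodeBN

/-! ### Local lower bounds in exponential families -/

namespace BayesMixture

/-- Locally uniform lower bound in an exponential family. -/
lemma eventually_exp_mul_le {Θ E : Type*} [TopologicalSpace Θ] {n : ℕ} {f : Θ → E → ℝ}
    {c : Fin n → Θ → ℝ} {φ : Fin n → E → ℝ} {G : E → ℝ} {θ₀ : Θ}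
    (hf : ∀ᶠ θ in 𝓝 θ₀, ∀ x, f θ x = Real.exp (∑ k, c k θ * φ k x))
    (hc : ∀ k, ContinuousAt (c k) θ₀) (hφ : ∀ k x, |φ k x| ≤ G x) (hG : ∀ x, 0 ≤ G x)
    {ε : ℝ} (hε : 0 < ε) :
    ∀ᶠ θ in 𝓝 θ₀, ∀ x, f θ₀ x * Real.exp (-(ε * G x)) ≤ f θ x := by
  -- The `n` coefficient errors must add up to at most `ε`; `n + 1` also avoids division by zero
  -- when `n = 0`.
  have h1 : ∀ᶠ θ in 𝓝 θ₀, ∀ k, |c k θ - c k θ₀| < ε / (n + 1) := by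
    refine eventually_all.2 fun k => ?_
    have := (Metric.tendsto_nhds.1 (hc k)) (ε / (n + 1)) (by positivity)
    simpa [Real.dist_eq] using this
  filter_upwards [h1, hf] with θ hθ hfθ x
  rw [hfθ, hf.self_of_nhds, ← Real.exp_add, Real.exp_le_exp]
  have h2 : ∑ k, (c k θ₀ * φ k x - c k θ * φ k x) ≤ ∑ _k : Fin n, ε / (n + 1) * G x := by
    refine Finset.sum_le_sum fun k _ => ?_
    have h3 : c k θ₀ * φ k x - c k θ * φ k x = -((c k θ - c k θ₀) * φ k x) := by ring
    rw [h3]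
    refine (neg_le_abs _).trans ?_
    rw [abs_mul]
    exact mul_le_mul (hθ k).le (hφ k x) (abs_nonneg _) (by positivity)
  rw [Finset.sum_sub_distrib, Finset.sum_const, Finset.card_univ, Fintype.card_fin,
    nsmul_eq_mul] at h2
  have h4 : (n : ℝ) * (ε / (n + 1) * G x) ≤ ε * G x := by
    have : (n : ℝ) * (ε / (n + 1) * G x) = ε * G x * (n / (n + 1)) := by ring
    rw [this]
    refine mul_le_of_le_one_right (mul_nonneg hε.le (hG x)) ?_
    rw [div_le_one (by positivity)]
    linarith
  linarith

end BayesMixture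

namespace TwoNodeBN

open BayesMixture

/-! ### One-dimensional normal densities -/

lemma log_gaussianPDFReal (m : ℝ) {v : ℝ≥0} (hv : v ≠ 0) (x : ℝ) :
    Real.log (gaussianPDFReal m v x)
      = -(1 / 2) * Real.log (2 * Real.pi * v) - (x - m) ^ 2 / (2 * v) := by
  have hv' : (0 : ℝ) < v := by positivity
  rw [gaussianPDFReal, Real.log_mul (by positivity) (Real.exp_pos _).ne', Real.log_inv,
    Real.log_sqrt (by positivity), Real.log_exp]
  ring

lemma gaussianPDFReal_eq_exp (m : ℝ) {v : ℝ≥0} (hv : v ≠ 0) (x : ℝ) :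
    gaussianPDFReal m v x
      = Real.exp (-(1 / 2) * Real.log (2 * Real.pi * v) - (x - m) ^ 2 / (2 * v)) := by
  rw [← log_gaussianPDFReal m hv, Real.exp_log (gaussianPDFReal_pos m v x hv)]

/-- The exponent is linear in the statistics `1`, `x`, `x ^ 2`, all dominated by `1 + x ^ 2`, with
coefficients continuous where the variance is positive. -/
lemma eventually_gaussianPDFReal_ge (m v : ℝ) (hv : 0 < v) {ε : ℝ} (hε : 0 < ε) :
    ∀ᶠ q : ℝ × ℝ in 𝓝 (m, v), ∀ x, gaussianPDFReal m v.toNNReal x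
      * Real.exp (-(ε * (1 + x ^ 2))) ≤ gaussianPDFReal q.1 q.2.toNNReal x := by
  refine eventually_exp_mul_le (θ₀ := (m, v)) (G := fun x => 1 + x ^ 2)
    (f := fun (q : ℝ × ℝ) x => gaussianPDFReal q.1 q.2.toNNReal x)
    (c := ![fun q => -(1 / 2) * Real.log (2 * Real.pi * q.2) - q.1 ^ 2 / (2 * q.2),
      fun q => q.1 / q.2, fun q => -(1 / (2 * q.2))])
    (φ := ![fun _ => 1, fun x => x, fun x => x ^ 2]) ?_ ?_ ?_ ?_ hε
  · have : ∀ᶠ q : ℝ × ℝ in 𝓝 (m, v), 0 < q.2 :=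
      continuousAt_snd.eventually (lt_mem_nhds hv)
    filter_upwards [this] with q hq x
    rw [gaussianPDFReal_eq_exp _ (by simpa using hq), Real.coe_toNNReal _ hq.le]
    simp only [Fin.sum_univ_three, Matrix.cons_val]
    congr 1
    field_simp
    ring
  · have h2 : (2 * v) ≠ 0 := by positivity
    have hpi : 2 * Real.pi * v ≠ 0 := by positivity
    intro k
    fin_cases k
    · exact (continuousAt_const.mul ((continuousAt_const.mul continuousAt_snd).log hpi)).sub
        ((continuousAt_fst.pow 2).div (continuousAt_const.mul continuousAt_snd) h2)
    · exact continuousAt_fst.div continuousAt_snd hv.ne'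
    · exact (continuousAt_const.div (continuousAt_const.mul continuousAt_snd) h2).neg
  · intro k x
    fin_cases k
    · simp; positivity
    · simp only [Fin.mk_one, Matrix.cons_val]
      rw [abs_le]; constructor <;> nlinarith [sq_nonneg (x + 1 / 2), sq_nonneg (x - 1 / 2)]
    · simp
  · intro x; positivity

lemma integrable_sq_sub_gaussianReal (m : ℝ) (v : ℝ≥0) (c : ℝ) :
    Integrable (fun x => (x - c) ^ 2) (gaussianReal m v) :=
  ((memLp_id_gaussianReal 2).sub (memLp_const c)).integrable_sq

lemma integrable_log_gaussianPDFReal (m : ℝ) {v : ℝ≥0} (hv : v ≠ 0) :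
    Integrable (fun x => Real.log (gaussianPDFReal m v x)) (gaussianReal m v) := by
  simp_rw [log_gaussianPDFReal m hv]
  exact (integrable_const _).sub ((integrable_sq_sub_gaussianReal m v m).div_const _)

lemma integral_log_gaussianPDFReal (m : ℝ) {v : ℝ≥0} (hv : v ≠ 0) :
    ∫ x, Real.log (gaussianPDFReal m v x) ∂(gaussianReal m v)
      = -(1 / 2) * Real.log (2 * Real.pi * v) - 1 / 2 := by
  have hv' : (0 : ℝ) < v := by positivity
  simp_rw [log_gaussianPDFReal m hv]
  rw [integral_sub (integrable_const _) ((integrable_sq_sub_gaussianReal m v m).div_const _),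
    integral_div]
  have h1 := variance_eq_integral (μ := gaussianReal m v) (X := fun x => x) aemeasurable_id
  rw [variance_fun_id_gaussianReal, integral_id_gaussianReal] at h1
  rw [← h1]
  simp
  field_simp

lemma lintegral_ofReal_gaussianPDFReal_le_one (m : ℝ) (v : ℝ≥0) :
    ∫⁻ x, ENNReal.ofReal (gaussianPDFReal m v x) ≤ 1 := by
  -- For zero variance `gaussianPDFReal` is identically zero, hence an inequality that holds for
  -- every parameter.
  by_cases hv : v = 0
  · simp [hv]
  · exact (lintegral_gaussianPDFReal_eq_one m hv).le

/-! ### Bivariate normal densities -/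

lemma posDef_symMatrix_iff (w : ℝ × ℝ × ℝ) :
    (symMatrix w).PosDef ↔ 0 < w.1 ∧ 0 < w.1 * w.2.2 - w.2.1 ^ 2 := by
  constructor
  · intro h
    refine ⟨by simpa [symMatrix] using h.diag_pos (i := 0), ?_⟩
    have := h.det_pos
    rw [symMatrix, Matrix.det_fin_two_of] at this
    linarith
  · rintro ⟨h1, h2⟩
    refine Matrix.PosDef.of_dotProduct_mulVec_pos ?_ fun x hx => ?_
    · ext i j
      fin_cases i <;> fin_cases j <;> simp [symMatrix]
    · have h3 : star x ⬝ᵥ (symMatrix w).mulVec x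
          = w.1 * x 0 ^ 2 + 2 * w.2.1 * x 0 * x 1 + w.2.2 * x 1 ^ 2 := by
        simp [symMatrix, dotProduct, Matrix.mulVec, Fin.sum_univ_two]
        ring
      rw [h3]
      -- Completing the square after multiplication by `w.1 > 0`.
      have h4 : w.1 * (w.1 * x 0 ^ 2 + 2 * w.2.1 * x 0 * x 1 + w.2.2 * x 1 ^ 2)
          = (w.1 * x 0 + w.2.1 * x 1) ^ 2 + (w.1 * w.2.2 - w.2.1 ^ 2) * x 1 ^ 2 := by ring
      refine pos_of_mul_pos_right (a := w.1) ?_ h1.le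
      rw [h4]
      by_cases hx1 : x 1 = 0
      · have hx0 : x 0 ≠ 0 := by
          intro hx0
          exact hx (by ext i; fin_cases i <;> simp [hx0, hx1])
        rw [hx1]
        have : 0 < (w.1 * x 0) ^ 2 := by positivity
        simpa using this
      · positivity

lemma posDef_symMatrix_snd_pos {w : ℝ × ℝ × ℝ} (h : (symMatrix w).PosDef) : 0 < w.2.2 := by
  simpa [symMatrix] using h.diag_pos (i := 1)

lemma isOpen_posDef_symMatrix : IsOpen {w | (symMatrix w).PosDef} := by
  simp only [posDef_symMatrix_iff, Set.ofPred_and]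
  refine (isOpen_lt ?_ ?_).inter (isOpen_lt ?_ ?_) <;> fun_prop

lemma normalPDF_symMatrix (m : Fin 2 → ℝ) (w : ℝ × ℝ × ℝ) (x : Fin 2 → ℝ) :
    normalPDF m (symMatrix w) x = Real.sqrt (w.1 * w.2.2 - w.2.1 ^ 2) / (2 * Real.pi)
      * Real.exp (-(1 / 2) * (w.1 * (x 0 - m 0) ^ 2 + 2 * w.2.1 * (x 0 - m 0) * (x 1 - m 1)
        + w.2.2 * (x 1 - m 1) ^ 2)) := by
  have h1 : (symMatrix w).det = w.1 * w.2.2 - w.2.1 ^ 2 := by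
    rw [symMatrix, Matrix.det_fin_two_of]; ring
  have h2 : (x - m) ⬝ᵥ (symMatrix w).mulVec (x - m)
      = w.1 * (x 0 - m 0) ^ 2 + 2 * w.2.1 * (x 0 - m 0) * (x 1 - m 1)
        + w.2.2 * (x 1 - m 1) ^ 2 := by
    simp [symMatrix, dotProduct, Matrix.mulVec, Fin.sum_univ_two]
    ring
  rw [normalPDF, h1, h2]
  norm_num

lemma normalPDF_nonneg {n : ℕ} (m : Fin n → ℝ) (W : Matrix (Fin n) (Fin n) ℝ) (x : Fin n → ℝ) :
    0 ≤ normalPDF m W x := by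
  unfold normalPDF
  positivity

/-- A bivariate normal density is a marginal density times a conditional density. -/
lemma normalPDF_eq_mul_gaussianPDFReal (m : Fin 2 → ℝ) {w : ℝ × ℝ × ℝ}
    (hw : (symMatrix w).PosDef) (x : Fin 2 → ℝ) :
    normalPDF m (symMatrix w) x
      = gaussianPDFReal (m 0) (w.2.2 / (w.1 * w.2.2 - w.2.1 ^ 2)).toNNReal (x 0)
        * gaussianPDFReal (m 1 - w.2.1 / w.2.2 * (x 0 - m 0)) (1 / w.2.2).toNNReal (x 1) := by
  obtain ⟨ha, hd⟩ := (posDef_symMatrix_iff w).1 hw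
  have hc := posDef_symMatrix_snd_pos hw
  rw [normalPDF_symMatrix, gaussianPDFReal, gaussianPDFReal, Real.coe_toNNReal _ (by positivity),
    Real.coe_toNNReal _ (by positivity)]
  set D := w.1 * w.2.2 - w.2.1 ^ 2 with hD
  have h1 : (√(2 * Real.pi * (w.2.2 / D)))⁻¹ * (√(2 * Real.pi * (1 / w.2.2)))⁻¹
      = √D / (2 * Real.pi) := by
    rw [← mul_inv, ← Real.sqrt_mul (by positivity)]
    have : 2 * Real.pi * (w.2.2 / D) * (2 * Real.pi * (1 / w.2.2)) = (2 * Real.pi) ^ 2 / D := by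
      field_simp
    rw [this, Real.sqrt_div (by positivity), Real.sqrt_sq (by positivity), inv_div]
  rw [mul_mul_mul_comm, h1, ← Real.exp_add]
  congr 2
  -- Eliminating `w.1` in favour of the determinant makes the two exponents agree as rational
  -- functions.
  have h2 : w.1 = (D + w.2.1 ^ 2) / w.2.2 := by rw [hD]; field_simp; ring
  rw [h2]
  field_simp
  ring

lemma lintegral_normalPDF (m : Fin 2 → ℝ) {w : ℝ × ℝ × ℝ} (hw : (symMatrix w).PosDef) :
    ∫⁻ z : ℝ × ℝ, ENNReal.ofReal (normalPDF m (symMatrix w) ![z.1, z.2]) = 1 := by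
  obtain ⟨ha, hd⟩ := (posDef_symMatrix_iff w).1 hw
  have hc := posDef_symMatrix_snd_pos hw
  have hm : Measurable fun z : ℝ × ℝ =>
      ENNReal.ofReal (normalPDF m (symMatrix w) ![z.1, z.2]) := by
    simp only [normalPDF_symMatrix, Matrix.cons_val]
    fun_prop
  rw [Measure.volume_eq_prod, lintegral_prod _ hm.aemeasurable]
  simp_rw [normalPDF_eq_mul_gaussianPDFReal m hw, ENNReal.ofReal_mul (gaussianPDFReal_nonneg _ _ _)]
  simp only [Matrix.cons_val]
  simp_rw [lintegral_const_mul' _ _ ENNReal.ofReal_ne_top]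
  have h1 : (1 / w.2.2).toNNReal ≠ 0 := by simpa using hc
  have h2 : (w.2.2 / (w.1 * w.2.2 - w.2.1 ^ 2)).toNNReal ≠ 0 := by
    rw [Ne, Real.toNNReal_eq_zero, not_le]; positivity
  simp_rw [lintegral_gaussianPDFReal_eq_one _ h1, mul_one]
  exact lintegral_gaussianPDFReal_eq_one _ h2

lemma lintegral_normalPDF_pi (m : Fin 2 → ℝ) {w : ℝ × ℝ × ℝ} (hw : (symMatrix w).PosDef) :
    ∫⁻ x, ENNReal.ofReal (normalPDF m (symMatrix w) x) = 1 := by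
  rw [← lintegral_normalPDF m hw, ← (volume_preserving_finTwoArrow ℝ).lintegral_comp]
  · refine lintegral_congr fun x => ?_
    congr 2
    ext i
    fin_cases i <;> simp [MeasurableEquiv.finTwoArrow]
  · simp only [normalPDF_symMatrix, Matrix.cons_val]
    fun_prop

/-- As in one dimension, with the six monomials of degree at most two as statistics; the logarithm
of the normalizing factor joins the coefficient of the constant one. -/
lemma eventually_normalPDF_ge (m : Fin 2 → ℝ) {w : ℝ × ℝ × ℝ} (hw : (symMatrix w).PosDef)
    {ε : ℝ} (hε : 0 < ε) :
    ∀ᶠ q : (Fin 2 → ℝ) × (ℝ × ℝ × ℝ) in 𝓝 (m, w), ∀ x : ℝ × ℝ,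
      normalPDF m (symMatrix w) ![x.1, x.2] * Real.exp (-(ε * (1 + x.1 ^ 2 + x.2 ^ 2)))
        ≤ normalPDF q.1 (symMatrix q.2) ![x.1, x.2] := by
  obtain ⟨ha, hd⟩ := (posDef_symMatrix_iff w).1 hw
  refine eventually_exp_mul_le (θ₀ := (m, w)) (G := fun x : ℝ × ℝ => 1 + x.1 ^ 2 + x.2 ^ 2)
    (f := fun (q : (Fin 2 → ℝ) × (ℝ × ℝ × ℝ)) x => normalPDF q.1 (symMatrix q.2) ![x.1, x.2])
    (c := ![fun q => Real.log (Real.sqrt (q.2.1 * q.2.2.2 - q.2.2.1 ^ 2) / (2 * Real.pi))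
        - 1 / 2 * (q.2.1 * q.1 0 ^ 2 + 2 * q.2.2.1 * q.1 0 * q.1 1 + q.2.2.2 * q.1 1 ^ 2),
      fun q => q.2.1 * q.1 0 + q.2.2.1 * q.1 1, fun q => q.2.2.2 * q.1 1 + q.2.2.1 * q.1 0,
      fun q => -(1 / 2) * q.2.1, fun q => -q.2.2.1, fun q => -(1 / 2) * q.2.2.2])
    (φ := ![fun _ => 1, fun x => x.1, fun x => x.2, fun x => x.1 ^ 2, fun x => x.1 * x.2,
      fun x => x.2 ^ 2]) ?_ ?_ ?_ ?_ hε
  · have : ∀ᶠ q : (Fin 2 → ℝ) × (ℝ × ℝ × ℝ) in 𝓝 (m, w), (symMatrix q.2).PosDef :=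
      (isOpen_posDef_symMatrix.preimage continuous_snd).mem_nhds hw
    filter_upwards [this] with q hq x
    obtain ⟨ha, hd⟩ := (posDef_symMatrix_iff q.2).1 hq
    rw [normalPDF_symMatrix]
    set A := Real.sqrt (q.2.1 * q.2.2.2 - q.2.2.1 ^ 2) / (2 * Real.pi) with hA
    have hA0 : 0 < A := by positivity
    rw [← Real.exp_log hA0, ← Real.exp_add]
    simp only [Fin.sum_univ_six, Matrix.cons_val, ← hA]
    congr 1
    ring
  · have hne : Real.sqrt (w.1 * w.2.2 - w.2.1 ^ 2) / (2 * Real.pi) ≠ 0 := by positivity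
    intro k
    fin_cases k
    · refine ContinuousAt.sub (ContinuousAt.log ?_ hne) ?_
      · exact Continuous.continuousAt (by fun_prop)
      · exact Continuous.continuousAt (by fun_prop)
    all_goals
      simp only [Fin.mk_one, Fin.reduceFinMk, Matrix.cons_val]
      exact Continuous.continuousAt (by fun_prop)
  · rintro k ⟨x, y⟩
    fin_cases k <;> simp only [Fin.zero_eta, Fin.mk_one, Fin.reduceFinMk, Matrix.cons_val] <;>
      rw [abs_le] <;> constructor <;>
      nlinarith [sq_nonneg (x + 1 / 2), sq_nonneg (x - 1 / 2), sq_nonneg (y + 1 / 2),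
        sq_nonneg (y - 1 / 2), sq_nonneg (x + y), sq_nonneg (x - y), sq_nonneg x, sq_nonneg y]
  · rintro ⟨x, y⟩; positivity

end TwoNodeBN

namespace TwoNodeBN

open BayesMixture

/-! ### The Normal-Wishart prior -/

lemma integrable_exp_neg_mul_abs {κ : ℝ} (hκ : 0 < κ) :
    Integrable fun x : ℝ => Real.exp (-(κ * |x|)) := by
  -- In `1 + x ^ 2`, the `1` is paid by `exp u ≥ 1` and `x ^ 2` by `exp u ≥ u ^ 2 / 2`, where `u = κ
  -- * |x|`.
  refine (integrable_inv_one_add_sq.const_mul (1 + 2 / κ ^ 2)).mono'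
    (Continuous.aestronglyMeasurable (by fun_prop)) (Eventually.of_forall fun x => ?_)
  rw [Real.norm_of_nonneg (Real.exp_pos _).le, Real.exp_neg, ← div_eq_mul_inv,
    le_div_iff₀ (by positivity), inv_mul_le_iff₀ (Real.exp_pos _)]
  have h0 : 0 ≤ κ * |x| := by positivity
  have h1 := Real.quadratic_le_exp_of_nonneg h0
  have h2 : x ^ 2 = 2 / κ ^ 2 * ((κ * |x|) ^ 2 / 2) := by
    rw [mul_pow, sq_abs]; field_simp
  have h3 : 0 < 2 / κ ^ 2 := by positivity
  rw [h2]
  have h4 : 2 / κ ^ 2 * ((κ * |x|) ^ 2 / 2) ≤ 2 / κ ^ 2 * Real.exp (κ * |x|) :=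
    mul_le_mul_of_nonneg_left (by linarith) h3.le
  have h5 := Real.one_le_exp h0
  linarith

/-- The `p`-th power of the inequality `s ≤ exp s` at `s = κ * u / p`. -/
lemma rpow_le_mul_exp {p κ u : ℝ} (hp : 0 < p) (hκ : 0 < κ) (hu : 0 ≤ u) :
    u ^ p ≤ (p / κ) ^ p * Real.exp (κ * u) := by
  have h1 : u ≤ p / κ * Real.exp (κ * u / p) := by
    have h2 := Real.add_one_le_exp (κ * u / p)
    have h3 : u = p / κ * (κ * u / p) := by field_simp
    have h4 : 0 < p / κ := by positivity
    nlinarith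
  refine (Real.rpow_le_rpow hu h1 hp.le).trans_eq ?_
  rw [Real.mul_rpow (by positivity) (Real.exp_pos _).le, ← Real.exp_mul]
  congr 2
  field_simp

variable {αμ αw t : ℝ}

lemma wishartPDF_symMatrix (t αw : ℝ) (w : ℝ × ℝ × ℝ) [Decidable (symMatrix w).PosDef] :
    wishartPDF (t • (1 : Matrix (Fin 2) (Fin 2) ℝ)) αw (symMatrix w)
      = if (symMatrix w).PosDef then
        (w.1 * w.2.2 - w.2.1 ^ 2) ^ ((αw - 3) / 2) /
          (2 ^ αw * multivariateGamma 2 (αw / 2) / (t ^ 2) ^ (αw / 2))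
            * Real.exp (-(t / 2) * (w.1 + w.2.2)) else 0 := by
  have h1 : (symMatrix w).det = w.1 * w.2.2 - w.2.1 ^ 2 := by
    rw [symMatrix, Matrix.det_fin_two_of]; ring
  have h2 : (t • (1 : Matrix (Fin 2) (Fin 2) ℝ)).det = t ^ 2 := by
    simp
  have h3 : (t • (1 : Matrix (Fin 2) (Fin 2) ℝ) * symMatrix w).trace = t * (w.1 + w.2.2) := by
    simp [symMatrix, Matrix.trace_fin_two, mul_add]
  rw [wishartPDF, h1, h2, h3]
  by_cases h : (symMatrix w).PosDef
  · rw [if_pos h, if_pos h]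
    have e1 : (αw - ((2 : ℕ) : ℝ) - 1) / 2 = (αw - 3) / 2 := by push_cast; ring
    have e2 : αw * ((2 : ℕ) : ℝ) / 2 = αw := by push_cast; ring
    rw [e1, e2]
    congr 2
    ring
  · rw [if_neg h, if_neg h]

lemma measurable_wishartPDF (t αw : ℝ) :
    Measurable fun w => wishartPDF (t • (1 : Matrix (Fin 2) (Fin 2) ℝ)) αw (symMatrix w) := by
  classical
  simp only [wishartPDF_symMatrix]
  exact Measurable.ite isOpen_posDef_symMatrix.measurableSet (by fun_prop) (by fun_prop)

lemma wishart_const_pos (hαw : 3 < αw) (ht : 0 < t) :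
    0 < 2 ^ αw * multivariateGamma 2 (αw / 2) / (t ^ 2) ^ (αw / 2) := by
  have h1 : 0 < multivariateGamma 2 (αw / 2) := by
    refine mul_pos (by positivity) (Finset.prod_pos fun j hj => Real.Gamma_pos_of_pos ?_)
    have : (j : ℝ) ≤ 2 := by exact_mod_cast (Finset.mem_Icc.1 hj).2
    linarith
  positivity

lemma wishartPDF_pos (hαw : 3 < αw) (ht : 0 < t) {w : ℝ × ℝ × ℝ} (hw : (symMatrix w).PosDef) :
    0 < wishartPDF (t • (1 : Matrix (Fin 2) (Fin 2) ℝ)) αw (symMatrix w) := by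
  classical
  rw [wishartPDF_symMatrix, if_pos hw]
  have := wishart_const_pos hαw ht
  have := ((posDef_symMatrix_iff w).1 hw).2
  positivity

/-- The determinant is at most the squared trace, so its power costs half of the exponential decay
in the trace and leaves the rate `t / 4`. Positive definiteness bounds `|w.2.1|` by half the trace,
so what is left dominates a product of three one-dimensional exponentials. -/
lemma integrable_wishartPDF (hαw : 3 < αw) (ht : 0 < t) :
    Integrable fun w => wishartPDF (t • (1 : Matrix (Fin 2) (Fin 2) ℝ)) αw (symMatrix w) := by
  classical
  set K := 2 ^ αw * multivariateGamma 2 (αw / 2) / (t ^ 2) ^ (αw / 2) with hK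
  have hK0 : 0 < K := wishart_const_pos hαw ht
  set C := ((αw - 3) / (t / 4)) ^ (αw - 3) / K with hC
  have hC0 : 0 < C := by
    have : 0 < αw - 3 := by linarith
    positivity
  -- The three absolute values add up to at most `3 / 2` of the trace, so `t / 8` in each variable
  -- fits below the rate `t / 4`.
  have ht8 : 0 < t / 8 := by positivity
  have hint : Integrable fun w : ℝ × ℝ × ℝ => C * (Real.exp (-(t / 8 * |w.1|))
      * (Real.exp (-(t / 8 * |w.2.1|)) * Real.exp (-(t / 8 * |w.2.2|)))) :=
    ((integrable_exp_neg_mul_abs ht8).mul_prod ((integrable_exp_neg_mul_abs ht8).mul_prod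
      (integrable_exp_neg_mul_abs ht8))).const_mul C
  refine hint.mono' (measurable_wishartPDF t αw).aestronglyMeasurable
    (Eventually.of_forall fun w => ?_)
  by_cases hw : (symMatrix w).PosDef
  swap
  · rw [wishartPDF_symMatrix, if_neg hw, norm_zero]; positivity
  rw [Real.norm_of_nonneg (wishartPDF_pos hαw ht hw).le, wishartPDF_symMatrix, if_pos hw, ← hK]
  obtain ⟨ha, hd⟩ := (posDef_symMatrix_iff w).1 hw
  have hc := posDef_symMatrix_snd_pos hw
  have hb : |w.2.1| ≤ (w.1 + w.2.2) / 2 := by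
    refine abs_le_of_sq_le_sq ?_ (by positivity)
    nlinarith [sq_nonneg (w.1 - w.2.2)]
  have h1 : (w.1 * w.2.2 - w.2.1 ^ 2) ^ ((αw - 3) / 2)
      ≤ ((αw - 3) / (t / 4)) ^ (αw - 3) * Real.exp (t / 4 * (w.1 + w.2.2)) := by
    refine le_trans ?_ (rpow_le_mul_exp (by linarith) (by positivity) (by positivity))
    have h2 : (w.1 + w.2.2) ^ (αw - 3) = ((w.1 + w.2.2) ^ 2) ^ ((αw - 3) / 2) := by
      rw [← Real.rpow_natCast, ← Real.rpow_mul (by positivity)]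
      congr 1
      push_cast; ring
    rw [h2]
    refine Real.rpow_le_rpow hd.le ?_ (by linarith)
    nlinarith [sq_nonneg w.2.1]
  calc (w.1 * w.2.2 - w.2.1 ^ 2) ^ ((αw - 3) / 2) / K * Real.exp (-(t / 2) * (w.1 + w.2.2))
      ≤ ((αw - 3) / (t / 4)) ^ (αw - 3) * Real.exp (t / 4 * (w.1 + w.2.2)) / K
        * Real.exp (-(t / 2) * (w.1 + w.2.2)) := by gcongr
    _ = C * Real.exp (-(t / 4) * (w.1 + w.2.2)) := by
        have : Real.exp (-(t / 4) * (w.1 + w.2.2))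
            = Real.exp (t / 4 * (w.1 + w.2.2)) * Real.exp (-(t / 2) * (w.1 + w.2.2)) := by
          rw [← Real.exp_add]; congr 1; ring
        rw [this, hC]; ring
    _ ≤ _ := by
        rw [← Real.exp_add, ← Real.exp_add]
        refine mul_le_mul_of_nonneg_left (Real.exp_le_exp.2 ?_) hC0.le
        rw [abs_of_pos ha, abs_of_pos hc]
        nlinarith

/-- The density of the Normal-Wishart prior with mean `0` and scale matrix `t I`. -/
noncomputable def normalWishartPDF (αμ αw t : ℝ) (q : (Fin 2 → ℝ) × (ℝ × ℝ × ℝ)) : ℝ≥0∞ :=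
  ENNReal.ofReal (wishartPDF (t • (1 : Matrix (Fin 2) (Fin 2) ℝ)) αw (symMatrix q.2)
    * normalPDF 0 (αμ • symMatrix q.2) q.1)

lemma normalWishart_eq (αμ αw t : ℝ) :
    normalWishart 0 (t • (1 : Matrix (Fin 2) (Fin 2) ℝ)) αμ αw
      = volume.withDensity (normalWishartPDF αμ αw t) := rfl

lemma smul_symMatrix (c : ℝ) (w : ℝ × ℝ × ℝ) : c • symMatrix w = symMatrix (c • w) := by
  ext i j
  fin_cases i <;> fin_cases j <;> simp [symMatrix]

lemma measurable_normalWishartPDF (αμ αw t : ℝ) : Measurable (normalWishartPDF αμ αw t) := by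
  refine (((measurable_wishartPDF t αw).comp measurable_snd).mul ?_).ennreal_ofReal
  simp only [smul_symMatrix, normalPDF_symMatrix, Prod.smul_fst, Prod.smul_snd, Pi.zero_apply]
  fun_prop

lemma normalWishartPDF_pos (hαμ : 0 < αμ) (hαw : 3 < αw) (ht : 0 < t)
    {q : (Fin 2 → ℝ) × (ℝ × ℝ × ℝ)} (hq : (symMatrix q.2).PosDef) :
    0 < normalWishartPDF αμ αw t q := by
  rw [normalWishartPDF, ENNReal.ofReal_pos]
  refine mul_pos (wishartPDF_pos hαw ht hq) ?_
  have := (hq.smul hαμ).det_pos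
  unfold normalPDF
  positivity

lemma eventually_normalWishartPDF_pos (hαμ : 0 < αμ) (hαw : 3 < αw) (ht : 0 < t)
    (m : Fin 2 → ℝ) {w : ℝ × ℝ × ℝ} (hw : (symMatrix w).PosDef) :
    ∀ᶠ q in 𝓝 (m, w), 0 < normalWishartPDF αμ αw t q := by
  have h : ∀ᶠ q : (Fin 2 → ℝ) × (ℝ × ℝ × ℝ) in 𝓝 (m, w), (symMatrix q.2).PosDef :=
    (isOpen_posDef_symMatrix.preimage continuous_snd).mem_nhds hw
  exact h.mono fun q hq => normalWishartPDF_pos hαμ hαw ht hq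

lemma ae_normalWishart_posDef (αμ αw t : ℝ) :
    ∀ᵐ q ∂(normalWishart 0 (t • (1 : Matrix (Fin 2) (Fin 2) ℝ)) αμ αw),
      (symMatrix q.2).PosDef := by
  rw [normalWishart_eq, ae_withDensity_iff (measurable_normalWishartPDF αμ αw t)]
  refine Eventually.of_forall fun q hq => ?_
  by_contra h
  exact hq (by simp [normalWishartPDF, wishartPDF, h])

/-- Integrating out the mean first removes the normal factor and leaves the Wishart density. -/
lemma isFiniteMeasure_normalWishart (hαμ : 0 < αμ) (hαw : 3 < αw) (ht : 0 < t) :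
    IsFiniteMeasure (normalWishart 0 (t • (1 : Matrix (Fin 2) (Fin 2) ℝ)) αμ αw) := by
  rw [normalWishart_eq]
  refine isFiniteMeasure_withDensity (ne_of_lt ?_)
  rw [Measure.volume_eq_prod,
    lintegral_prod_symm _ (measurable_normalWishartPDF αμ αw t).aemeasurable]
  have h1 : ∀ w : ℝ × ℝ × ℝ, ∫⁻ m, normalWishartPDF αμ αw t (m, w)
      = ENNReal.ofReal (wishartPDF (t • (1 : Matrix (Fin 2) (Fin 2) ℝ)) αw (symMatrix w)) := by
    intro w
    by_cases hw : (symMatrix w).PosDef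
    swap
    · simp [normalWishartPDF, wishartPDF, hw]
    simp only [normalWishartPDF]
    simp_rw [ENNReal.ofReal_mul (wishartPDF_pos hαw ht hw).le]
    rw [lintegral_const_mul' _ _ ENNReal.ofReal_ne_top]
    have h2 : (symMatrix (αμ • w)).PosDef := by
      rw [← smul_symMatrix]; exact hw.smul hαμ
    simp_rw [smul_symMatrix]
    rw [lintegral_normalPDF_pi 0 h2, mul_one]
  simp_rw [h1]
  exact (integrable_wishartPDF hαw ht).lintegral_lt_top

/-! ### The BGe likelihoods -/

/-- The likelihood of an observation in the unrestricted bivariate normal model. -/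
noncomputable def edgeLik (q : (Fin 2 → ℝ) × (ℝ × ℝ × ℝ)) (x : ℝ × ℝ) : ℝ :=
  normalPDF q.1 (symMatrix q.2) ![x.1, x.2]

/-- The likelihood of an observation of the `i`-th variable alone. -/
noncomputable def nodeLik (i : Fin 2) (q : (Fin 2 → ℝ) × (ℝ × ℝ × ℝ)) (x : ℝ) : ℝ :=
  gaussianPDFReal (q.1 i) (Real.toNNReal ((symMatrix q.2)⁻¹ i i)) x

lemma edgeLik_nonneg (q : (Fin 2 → ℝ) × (ℝ × ℝ × ℝ)) (x : ℝ × ℝ) : 0 ≤ edgeLik q x :=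
  normalPDF_nonneg _ _ _

lemma lintegral_edgeLik {q : (Fin 2 → ℝ) × (ℝ × ℝ × ℝ)} (hq : (symMatrix q.2).PosDef) :
    ∫⁻ x, ENNReal.ofReal (edgeLik q x) = 1 :=
  lintegral_normalPDF q.1 hq

lemma measurable_edgeLik :
    Measurable fun z : ((Fin 2 → ℝ) × (ℝ × ℝ × ℝ)) × (ℝ × ℝ) => edgeLik z.1 z.2 := by
  simp only [edgeLik, normalPDF_symMatrix, Matrix.cons_val]
  fun_prop

lemma inv_symMatrix_apply (w : ℝ × ℝ × ℝ) (i : Fin 2) :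
    (symMatrix w)⁻¹ i i = (![w.2.2, w.1] i) / (w.1 * w.2.2 - w.2.1 ^ 2) := by
  have h1 : (symMatrix w).det = w.1 * w.2.2 - w.2.1 ^ 2 := by
    rw [symMatrix, Matrix.det_fin_two_of]; ring
  rw [Matrix.inv_def, h1, Ring.inverse_eq_inv', symMatrix, Matrix.adjugate_fin_two_of]
  fin_cases i <;> simp <;> ring

lemma measurable_inv_symMatrix_apply (i : Fin 2) :
    Measurable fun w => (symMatrix w)⁻¹ i i := by
  simp only [inv_symMatrix_apply]
  fin_cases i <;> simp <;> fun_prop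

lemma measurable_nodeLik (i : Fin 2) :
    Measurable fun z : ((Fin 2 → ℝ) × (ℝ × ℝ × ℝ)) × ℝ => nodeLik i z.1 z.2 := by
  have h : Measurable fun z : ((Fin 2 → ℝ) × (ℝ × ℝ × ℝ)) × ℝ =>
      (z.1.1 i, Real.toNNReal ((symMatrix z.1.2)⁻¹ i i), z.2) :=
    Measurable.prodMk (by fun_prop) (Measurable.prodMk
      (((measurable_inv_symMatrix_apply i).comp (by fun_prop)).real_toNNReal) (by fun_prop))
  exact measurable_uncurry_gaussianPDFReal.comp h

lemma bgeLikelihood_edge (ν : Fin 2 → ℝ) (T : Matrix (Fin 2) (Fin 2) ℝ) (αμ αw : ℝ) {N : ℕ}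
    (x : Fin N → ℝ × ℝ) :
    bgeLikelihood ν T αμ αw x .edge = marginal (normalWishart ν T αμ αw) edgeLik x := rfl

/-- The product prior factors the integral, and each pushforward is pulled back to the full
Normal-Wishart measure, so the marginal priors need no explicit density. -/
lemma bgeLikelihood_indep (hαμ : 0 < αμ) (hαw : 3 < αw) (ht : 0 < t) {N : ℕ}
    (x : Fin N → ℝ × ℝ) :
    bgeLikelihood 0 (t • (1 : Matrix (Fin 2) (Fin 2) ℝ)) αμ αw x .indep
      = marginal (normalWishart 0 (t • (1 : Matrix (Fin 2) (Fin 2) ℝ)) αμ αw) (nodeLik 0)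
          (fun j => (x j).1)
        * marginal (normalWishart 0 (t • (1 : Matrix (Fin 2) (Fin 2) ℝ)) αμ αw) (nodeLik 1)
          (fun j => (x j).2) := by
  have := isFiniteMeasure_normalWishart hαμ hαw ht
  have hi : ∀ i : Fin 2, Measurable fun q : (Fin 2 → ℝ) × (ℝ × ℝ × ℝ) =>
      (q.1 i, Real.toNNReal ((symMatrix q.2)⁻¹ i i)) := fun i =>
    Measurable.prodMk (by fun_prop)
      (((measurable_inv_symMatrix_apply i).comp measurable_snd).real_toNNReal)
  have : ∀ i, IsFiniteMeasure (normalWishartMarginal 0 (t • (1 : Matrix (Fin 2) (Fin 2) ℝ)) αμ αw i) :=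
    fun i => Measure.isFiniteMeasure_map _ _
  have hm : ∀ y : Fin N → ℝ,
      Measurable fun q : ℝ × ℝ≥0 => ∏ j, gaussianPDFReal q.1 q.2 (y j) := fun y => by
    refine Finset.measurable_prod _ fun j _ => ?_
    have h : Measurable fun q : ℝ × ℝ≥0 => (q.1, q.2, y j) := by fun_prop
    exact measurable_uncurry_gaussianPDFReal.comp h
  simp only [bgeLikelihood, Finset.prod_mul_distrib]
  rw [integral_prod_mul (fun q : ℝ × ℝ≥0 => ∏ j, gaussianPDFReal q.1 q.2 (x j).1)
    (fun q : ℝ × ℝ≥0 => ∏ j, gaussianPDFReal q.1 q.2 (x j).2),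
    normalWishartMarginal, normalWishartMarginal,
    integral_map (hi 0).aemeasurable (hm _).aestronglyMeasurable,
    integral_map (hi 1).aemeasurable (hm _).aestronglyMeasurable]
  rfl

instance : (volume : Measure ((Fin 2 → ℝ) × (ℝ × ℝ × ℝ))).IsOpenPosMeasure :=
  Measure.prod.instIsOpenPosMeasure

/-- Since `P` has density `edgeLik (m, w)`, the mean of a likelihood ratio is the Lebesgue integral
of another normal density. -/
lemma regular_edgeLik (hαμ : 0 < αμ) (hαw : 3 < αw) (ht : 0 < t) (m : Fin 2 → ℝ)
    {w : ℝ × ℝ × ℝ} (hw : (symMatrix w).PosDef) {P : Measure (ℝ × ℝ)} [IsProbabilityMeasure P]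
    (hP : P = volume.withDensity fun x => ENNReal.ofReal (edgeLik (m, w) x))
    (hlog : Integrable (fun x => Real.log (edgeLik (m, w) x)) P)
    (h1 : Integrable (fun x => x.1 ^ 2) P) (h2 : Integrable (fun x => x.2 ^ 2) P) :
    Regular P (normalWishart 0 (t • (1 : Matrix (Fin 2) (Fin 2) ℝ)) αμ αw) edgeLik
      (edgeLik (m, w)) := by
  have hpos : ∀ x, 0 < edgeLik (m, w) x := fun x => by
    have := hw.det_pos
    unfold edgeLik normalPDF
    positivity
  have hmeas : ∀ q, Measurable (edgeLik q) := fun q =>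
    measurable_edgeLik.of_uncurry_left
  have hr : ∀ q : (Fin 2 → ℝ) × (ℝ × ℝ × ℝ), (symMatrix q.2).PosDef →
      Integrable (fun x => edgeLik q x / edgeLik (m, w) x) P ∧
        ∫ x, edgeLik q x / edgeLik (m, w) x ∂P ≤ 1 := fun q hq => by
    rw [hP]
    exact integrable_div_density (hmeas _) hpos (hmeas q) (edgeLik_nonneg q)
      (lintegral_edgeLik hq).le
  have hlow : ∀ ε : ℝ, 0 < ε → ∀ᶠ q in 𝓝 (m, w), ∀ x,
      edgeLik (m, w) x * Real.exp (-(ε * (1 + x.1 ^ 2 + x.2 ^ 2))) ≤ edgeLik q x :=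
    fun ε hε => eventually_normalPDF_ge m hw hε
  exact
  { measurable_lik := measurable_edgeLik
    measurable_ref := hmeas _
    ref_pos := hpos
    integrable_log := hlog
    nonneg := Eventually.of_forall edgeLik_nonneg
    integrable_ratio := (ae_normalWishart_posDef αμ αw t).mono fun q hq => (hr q hq).1
    integral_ratio_le := (ae_normalWishart_posDef αμ αw t).mono fun q hq => (hr q hq).2
    exists_lower := by
      refine ⟨fun x => 1 + x.1 ^ 2 + x.2 ^ 2, ((integrable_const _).add h1).add h2, fun ε hε =>
        exists_measurableSet_withDensity_ne_zero volume (measurable_normalWishartPDF αμ αw t)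
          (eventually_normalWishartPDF_pos hαμ hαw ht m hw) (hlow ε hε)⟩ }

lemma regular_nodeLik (hαμ : 0 < αμ) (hαw : 3 < αw) (ht : 0 < t) (i : Fin 2) (m : ℝ) {v : ℝ}
    (hv : 0 < v) :
    Regular (gaussianReal m v.toNNReal)
      (normalWishart 0 (t • (1 : Matrix (Fin 2) (Fin 2) ℝ)) αμ αw) (nodeLik i)
      (gaussianPDFReal m v.toNNReal) := by
  have hv' : v.toNNReal ≠ 0 := by simpa using hv
  have hr : ∀ q : (Fin 2 → ℝ) × (ℝ × ℝ × ℝ),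
      Integrable (fun x => nodeLik i q x / gaussianPDFReal m v.toNNReal x)
        (gaussianReal m v.toNNReal) ∧
      ∫ x, nodeLik i q x / gaussianPDFReal m v.toNNReal x ∂(gaussianReal m v.toNNReal) ≤ 1 :=
    fun q => by
    rw [gaussianReal_of_var_ne_zero m hv']
    exact integrable_div_density (measurable_gaussianPDFReal _ _)
      (fun x => gaussianPDFReal_pos _ _ _ hv') (measurable_gaussianPDFReal _ _)
      (fun x => gaussianPDFReal_nonneg _ _ _) (lintegral_ofReal_gaussianPDFReal_le_one _ _)
  exact
  { measurable_lik := measurable_nodeLik i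
    measurable_ref := measurable_gaussianPDFReal _ _
    ref_pos := fun x => gaussianPDFReal_pos _ _ _ hv'
    integrable_log := integrable_log_gaussianPDFReal m hv'
    nonneg := Eventually.of_forall fun q x => gaussianPDFReal_nonneg _ _ _
    integrable_ratio := Eventually.of_forall fun q => (hr q).1
    integral_ratio_le := Eventually.of_forall fun q => (hr q).2
    exists_lower := by
      -- Any parameter that induces mean `m` and variance `v` at node `i` will do; this diagonal
      -- precision matrix serves both nodes.
      have hw : (symMatrix (1 / v, 0, 1 / v)).PosDef := by
        rw [posDef_symMatrix_iff]
        constructor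
        · positivity
        · simp only [ne_eq, OfNat.ofNat_ne_zero, not_false_eq_true, zero_pow, sub_zero]
          positivity
      have hinv : (symMatrix (1 / v, 0, 1 / v))⁻¹ i i = v := by
        rw [inv_symMatrix_apply]
        fin_cases i <;> simp
      refine ⟨fun x => 1 + x ^ 2, (integrable_const _).add ?_, fun ε hε =>
        exists_measurableSet_withDensity_ne_zero volume (measurable_normalWishartPDF αμ αw t)
          (eventually_normalWishartPDF_pos hαμ hαw ht (fun _ => m) hw) ?_⟩
      · simpa using integrable_sq_sub_gaussianReal m v.toNNReal 0
      · have hcont : ContinuousAt (fun q : (Fin 2 → ℝ) × (ℝ × ℝ × ℝ) =>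
            (q.1 i, (symMatrix q.2)⁻¹ i i)) (fun _ => m, (1 / v, 0, 1 / v)) := by
          refine ContinuousAt.prodMk (Continuous.continuousAt (by fun_prop)) ?_
          simp only [inv_symMatrix_apply]
          refine ContinuousAt.div ?_ (Continuous.continuousAt (by fun_prop)) ?_
          · fin_cases i <;> simp <;> exact Continuous.continuousAt (by fun_prop)
          · exact ((posDef_symMatrix_iff _).1 hw).2.ne'
        have h := eventually_gaussianPDFReal_ge m v hv hε
        have h2 : Tendsto (fun q : (Fin 2 → ℝ) × (ℝ × ℝ × ℝ) =>
            (q.1 i, (symMatrix q.2)⁻¹ i i)) (𝓝 (fun _ => m, (1 / v, 0, 1 / v))) (𝓝 (m, v)) := by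
          have h3 := hcont.tendsto
          simp only [hinv] at h3
          exact h3
        exact h2.eventually h }

end TwoNodeBN

namespace TwoNodeBN

open BayesMixture

/-! ### The data generating process -/

lemma gaussianReal_eq_map_std (m σ : ℝ) :
    gaussianReal m (σ ^ 2).toNNReal = (gaussianReal 0 1).map fun z => m + σ * z := by
  have h1 := gaussianReal_map_const_mul (μ := 0) (v := 1) σ
  have h2 := gaussianReal_map_const_add (μ := σ * 0) (v := NNReal.mk (σ ^ 2) (sq_nonneg σ) * 1) m
  rw [← h1, Measure.map_map (by fun_prop) (by fun_prop)] at h2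
  have h3 : (fun z => m + σ * z) = (fun x => m + x) ∘ fun x => σ * x := rfl
  rw [h3, h2]
  congr 1
  · simp
  · ext; simp [sq_nonneg]

/-- The pair `(X₁, X₂)` as a function of two independent standard normal variables. -/
noncomputable def pairOfStd (μ₁ μ₂ β σ₁ σ₂ : ℝ) (z : ℝ × ℝ) : ℝ × ℝ :=
  (μ₁ + σ₁ * z.1, μ₂ + β * (μ₁ + σ₁ * z.1) + σ₂ * z.2)

lemma measurable_pairOfStd (μ₁ μ₂ β σ₁ σ₂ : ℝ) : Measurable (pairOfStd μ₁ μ₂ β σ₁ σ₂) := by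
  unfold pairOfStd
  fun_prop

/-- Reduces moments, the law of `X₂` and quadrant probabilities to independent standard normal
variables. -/
lemma linearGaussian_eq_map (μ₁ μ₂ β σ₁ σ₂ : ℝ) :
    linearGaussian μ₁ μ₂ β σ₁ σ₂
      = ((gaussianReal 0 1).prod (gaussianReal 0 1)).map (pairOfStd μ₁ μ₂ β σ₁ σ₂) := by
  refine Measure.ext_of_lintegral _ fun f hf => ?_
  have hk : ∀ x, linearGaussianKernel μ₂ β σ₂ x
      = (gaussianReal 0 1).map fun z => μ₂ + β * x + σ₂ * z := fun x =>
    gaussianReal_eq_map_std _ _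
  have hf1 : Measurable fun x => ∫⁻ z, f (x, μ₂ + β * x + σ₂ * z) ∂(gaussianReal 0 1) :=
    Measurable.lintegral_prod_right' (f := fun p : ℝ × ℝ => f (p.1, μ₂ + β * p.1 + σ₂ * p.2))
      (hf.comp (by fun_prop))
  have hin : ∀ x, ∫⁻ y, f (x, y) ∂(linearGaussianKernel μ₂ β σ₂ x)
      = ∫⁻ z, f (x, μ₂ + β * x + σ₂ * z) ∂(gaussianReal 0 1) := fun x => by
    have hfx : Measurable fun y => f (x, y) := hf.comp measurable_prodMk_left
    rw [hk, lintegral_map hfx (by fun_prop)]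
  have hfp : Measurable fun z => f (pairOfStd μ₁ μ₂ β σ₁ σ₂ z) :=
    hf.comp (measurable_pairOfStd _ _ _ _ _)
  rw [linearGaussian, Measure.lintegral_compProd hf, lintegral_congr hin, gaussianReal_eq_map_std,
    lintegral_map hf1 (by fun_prop), lintegral_map hf (measurable_pairOfStd _ _ _ _ _),
    lintegral_prod _ hfp.aemeasurable]
  rfl

lemma linearGaussian_map_fst (μ₁ μ₂ β σ₁ σ₂ : ℝ) :
    (linearGaussian μ₁ μ₂ β σ₁ σ₂).map Prod.fst = gaussianReal μ₁ (σ₁ ^ 2).toNNReal :=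
  Measure.fst_compProd _ _

lemma linearGaussian_map_snd (μ₁ μ₂ β σ₁ σ₂ : ℝ) :
    (linearGaussian μ₁ μ₂ β σ₁ σ₂).map Prod.snd
      = gaussianReal (μ₂ + β * μ₁) (σ₂ ^ 2 + β ^ 2 * σ₁ ^ 2).toNNReal := by
  have h1 : (Prod.snd ∘ pairOfStd μ₁ μ₂ β σ₁ σ₂)
      = (fun p : ℝ × ℝ => p.1 + p.2) ∘ Prod.map (fun z => (μ₂ + β * μ₁) + (β * σ₁) * z)
        (fun z => 0 + σ₂ * z) := by
    ext z
    simp [pairOfStd]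
    ring
  rw [linearGaussian_eq_map, Measure.map_map measurable_snd (measurable_pairOfStd _ _ _ _ _), h1,
    ← Measure.map_map (by fun_prop) (by fun_prop),
    ← Measure.map_prod_map _ _ (by fun_prop) (by fun_prop), ← gaussianReal_eq_map_std,
    ← gaussianReal_eq_map_std]
  have h2 := gaussianReal_conv_gaussianReal (m₁ := μ₂ + β * μ₁) (m₂ := 0)
    (v₁ := ((β * σ₁) ^ 2).toNNReal) (v₂ := (σ₂ ^ 2).toNNReal)
  rw [Measure.conv] at h2
  rw [h2, add_zero, ← Real.toNNReal_add (by positivity) (by positivity)]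
  congr 2
  ring

/-- The precision matrix of `linearGaussian`. -/
noncomputable def dataPrecision (β σ₁ σ₂ : ℝ) : ℝ × ℝ × ℝ :=
  (1 / σ₁ ^ 2 + β ^ 2 / σ₂ ^ 2, -β / σ₂ ^ 2, 1 / σ₂ ^ 2)

section

variable {σ₁ σ₂ : ℝ} (hσ₁ : 0 < σ₁) (hσ₂ : 0 < σ₂) (μ₁ μ₂ β : ℝ)

include hσ₁ hσ₂

lemma det_dataPrecision : (dataPrecision β σ₁ σ₂).1 * (dataPrecision β σ₁ σ₂).2.2
    - (dataPrecision β σ₁ σ₂).2.1 ^ 2 = 1 / (σ₁ ^ 2 * σ₂ ^ 2) := by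
  simp only [dataPrecision]
  field_simp
  ring

lemma posDef_dataPrecision : (symMatrix (dataPrecision β σ₁ σ₂)).PosDef := by
  rw [posDef_symMatrix_iff, det_dataPrecision hσ₁ hσ₂]
  refine ⟨?_, by positivity⟩
  simp only [dataPrecision]
  positivity

/-- In a precision matrix `-w₁₂ / w₂₂` is the regression coefficient of `X₂` on `X₁` and `1 / w₂₂`
the residual variance. Thus the data law belongs to the unrestricted model. -/
lemma edgeLik_dataPrecision (x : ℝ × ℝ) :
    edgeLik (![μ₁, μ₂ + β * μ₁], dataPrecision β σ₁ σ₂) x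
      = gaussianPDFReal μ₁ (σ₁ ^ 2).toNNReal x.1
        * gaussianPDFReal (μ₂ + β * x.1) (σ₂ ^ 2).toNNReal x.2 := by
  rw [edgeLik, normalPDF_eq_mul_gaussianPDFReal _ (posDef_dataPrecision hσ₁ hσ₂ β),
    det_dataPrecision hσ₁ hσ₂]
  simp only [dataPrecision, Matrix.cons_val]
  congr 3
  · field_simp
  · field_simp
    ring
  · field_simp

lemma linearGaussian_eq_withDensity :
    linearGaussian μ₁ μ₂ β σ₁ σ₂ = volume.withDensity fun x =>
      ENNReal.ofReal (edgeLik (![μ₁, μ₂ + β * μ₁], dataPrecision β σ₁ σ₂) x) := by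
  have hv₁ : (σ₁ ^ 2).toNNReal ≠ 0 := by simp; positivity
  have hv₂ : (σ₂ ^ 2).toNNReal ≠ 0 := by simp; positivity
  have hm : Measurable (edgeLik (![μ₁, μ₂ + β * μ₁], dataPrecision β σ₁ σ₂)) :=
    measurable_edgeLik.of_uncurry_left
  refine Measure.ext_of_lintegral _ fun f hf => ?_
  have hk : ∀ x, ∫⁻ y, f (x, y) ∂(linearGaussianKernel μ₂ β σ₂ x)
      = ∫⁻ y, ENNReal.ofReal (gaussianPDFReal (μ₂ + β * x) (σ₂ ^ 2).toNNReal y) * f (x, y) :=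
    fun x => by
    have hfx : Measurable fun y => f (x, y) := hf.comp measurable_prodMk_left
    change ∫⁻ y, f (x, y) ∂(gaussianReal (μ₂ + β * x) (σ₂ ^ 2).toNNReal) = _
    rw [gaussianReal_of_var_ne_zero _ hv₂, lintegral_withDensity_eq_lintegral_mul _
      (measurable_gaussianPDF _ _) hfx]
    rfl
  have hmk : Measurable fun x => ∫⁻ y, f (x, y) ∂(linearGaussianKernel μ₂ β σ₂ x) :=
    hf.lintegral_kernel_prod_right'
  rw [linearGaussian, Measure.lintegral_compProd hf, gaussianReal_of_var_ne_zero _ hv₁,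
    lintegral_withDensity_eq_lintegral_mul _ (measurable_gaussianPDF _ _) hmk,
    lintegral_withDensity_eq_lintegral_mul _ hm.ennreal_ofReal hf, Measure.volume_eq_prod,
    lintegral_prod _ (hm.ennreal_ofReal.mul hf).aemeasurable]
  refine lintegral_congr fun x => ?_
  simp only [Pi.mul_apply, edgeLik_dataPrecision hσ₁ hσ₂]
  rw [hk, gaussianPDF, ← lintegral_const_mul' _ _ ENNReal.ofReal_ne_top]
  refine lintegral_congr fun y => ?_
  rw [ENNReal.ofReal_mul (gaussianPDFReal_nonneg _ _ _), mul_assoc]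

/-- In the noise coordinates the log density is a constant minus half the squared norm. The terms `-
0` match the integrand of the variance formula. -/
lemma log_edgeLik_pairOfStd (z : ℝ × ℝ) :
    Real.log (edgeLik (![μ₁, μ₂ + β * μ₁], dataPrecision β σ₁ σ₂) (pairOfStd μ₁ μ₂ β σ₁ σ₂ z))
      = -(1 / 2) * Real.log (2 * Real.pi * σ₁ ^ 2) - 1 / 2 * Real.log (2 * Real.pi * σ₂ ^ 2)
        - ((z.1 - 0) ^ 2 / 2 + (z.2 - 0) ^ 2 / 2) := by
  have hv₁ : (σ₁ ^ 2).toNNReal ≠ 0 := by simp; positivity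
  have hv₂ : (σ₂ ^ 2).toNNReal ≠ 0 := by simp; positivity
  rw [edgeLik_dataPrecision hσ₁ hσ₂, Real.log_mul (gaussianPDFReal_pos _ _ _ hv₁).ne'
    (gaussianPDFReal_pos _ _ _ hv₂).ne', log_gaussianPDFReal _ hv₁, log_gaussianPDFReal _ hv₂,
    Real.coe_toNNReal _ (by positivity), Real.coe_toNNReal _ (by positivity)]
  simp only [pairOfStd]
  field_simp
  ring

lemma integrable_log_edgeLik :
    Integrable (fun x => Real.log (edgeLik (![μ₁, μ₂ + β * μ₁], dataPrecision β σ₁ σ₂) x))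
      (linearGaussian μ₁ μ₂ β σ₁ σ₂) := by
  have hm : Measurable (edgeLik (![μ₁, μ₂ + β * μ₁], dataPrecision β σ₁ σ₂)) :=
    measurable_edgeLik.of_uncurry_left
  have hl : Measurable fun x =>
      Real.log (edgeLik (![μ₁, μ₂ + β * μ₁], dataPrecision β σ₁ σ₂) x) := hm.log
  rw [linearGaussian_eq_map, integrable_map_measure
    hl.aestronglyMeasurable (measurable_pairOfStd _ _ _ _ _).aemeasurable]
  simp only [Function.comp_def, log_edgeLik_pairOfStd hσ₁ hσ₂]
  have h := (integrable_sq_sub_gaussianReal 0 1 0).div_const 2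
  exact (integrable_const _).sub ((h.comp_fst _).add (h.comp_snd _))

lemma integral_log_edgeLik :
    ∫ x, Real.log (edgeLik (![μ₁, μ₂ + β * μ₁], dataPrecision β σ₁ σ₂) x)
      ∂(linearGaussian μ₁ μ₂ β σ₁ σ₂)
      = -(1 / 2) * Real.log (2 * Real.pi * σ₁ ^ 2) - 1 / 2 * Real.log (2 * Real.pi * σ₂ ^ 2)
        - 1 := by
  have hm : Measurable (edgeLik (![μ₁, μ₂ + β * μ₁], dataPrecision β σ₁ σ₂)) :=
    measurable_edgeLik.of_uncurry_left
  have hl : Measurable fun x =>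
      Real.log (edgeLik (![μ₁, μ₂ + β * μ₁], dataPrecision β σ₁ σ₂) x) := hm.log
  have h := (integrable_sq_sub_gaussianReal 0 1 0).div_const 2
  have h1 := variance_eq_integral (μ := gaussianReal 0 1) (X := fun x => x) aemeasurable_id
  rw [variance_fun_id_gaussianReal, integral_id_gaussianReal] at h1
  rw [linearGaussian_eq_map, integral_map (measurable_pairOfStd _ _ _ _ _).aemeasurable
    hl.aestronglyMeasurable]
  simp only [log_edgeLik_pairOfStd hσ₁ hσ₂]
  rw [integral_sub (integrable_const _) ((h.comp_fst _).fun_add (h.comp_snd _)),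
    integral_add (h.comp_fst _) (h.comp_snd _), integral_fun_fst (fun x : ℝ => (x - 0) ^ 2 / 2),
    integral_fun_snd (fun x : ℝ => (x - 0) ^ 2 / 2), integral_div, ← h1]
  simp
  norm_num

/-- The limit of the expected log posterior ratio per sample under the BGe score, with
integrability of the log posterior ratio. -/
theorem tendsto_expectedRatioBGe {prior : Graph → ℝ} (hprior : ∀ G, 0 < prior G) {αμ αw t : ℝ}
    (hαμ : 0 < αμ) (hαw : 3 < αw) (ht : 0 < t) :
    (∀ N : ℕ, Integrable
        (fun x : Fin N → ℝ × ℝ => bgeLogRatio prior 0 (t • (1 : Matrix (Fin 2) (Fin 2) ℝ)) αμ αw x)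
        (sampleLaw (linearGaussian μ₁ μ₂ β σ₁ σ₂) N)) ∧
      Tendsto
        (expectedRatioBGe prior 0 (t • (1 : Matrix (Fin 2) (Fin 2) ℝ)) αμ αw
          (linearGaussian μ₁ μ₂ β σ₁ σ₂))
        atTop (𝓝 (1 / 2 * Real.log ((σ₂ ^ 2 + β ^ 2 * σ₁ ^ 2) / σ₂ ^ 2))) := by
  have := isFiniteMeasure_normalWishart hαμ hαw ht
  have hv₁ : 0 < σ₁ ^ 2 := by positivity
  have hv₂ : 0 < σ₂ ^ 2 + β ^ 2 * σ₁ ^ 2 := by positivity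
  have hsq : ∀ {g : ℝ × ℝ → ℝ} {m : ℝ} {v : ℝ≥0}, Measurable g →
      (linearGaussian μ₁ μ₂ β σ₁ σ₂).map g = gaussianReal m v →
      Integrable (fun x => g x ^ 2) (linearGaussian μ₁ μ₂ β σ₁ σ₂) := fun {g m v} hg hP => by
    have h := integrable_sq_sub_gaussianReal m v 0
    rw [← hP, integrable_map_measure (by fun_prop) hg.aemeasurable] at h
    simpa [Function.comp_def] using h
  have r := regular_edgeLik hαμ hαw ht ![μ₁, μ₂ + β * μ₁] (posDef_dataPrecision hσ₁ hσ₂ β)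
    (linearGaussian_eq_withDensity hσ₁ hσ₂ μ₁ μ₂ β) (integrable_log_edgeLik hσ₁ hσ₂ μ₁ μ₂ β)
    (hsq measurable_fst (linearGaussian_map_fst _ _ _ _ _))
    (hsq measurable_snd (linearGaussian_map_snd _ _ _ _ _))
  have r1 := regular_nodeLik hαμ hαw ht 0 μ₁ hv₁
  have r2 := regular_nodeLik hαμ hαw ht 1 (μ₂ + β * μ₁) hv₂
  rw [← linearGaussian_map_fst μ₁ μ₂ β σ₁ σ₂] at r1
  rw [← linearGaussian_map_snd] at r2
  have he := fun (N : ℕ) (x : Fin N → ℝ × ℝ) =>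
    bgeLikelihood_edge 0 (t • (1 : Matrix (Fin 2) (Fin 2) ℝ)) αμ αw x
  have hi := fun (N : ℕ) (x : Fin N → ℝ × ℝ) => bgeLikelihood_indep hαμ hαw ht x
  refine ⟨fun N => integrable_logPosteriorRatio r r1 r2 hprior he hi N, ?_⟩
  have key := tendsto_integral_logPosteriorRatio r r1 r2 hprior he hi
  refine key.trans (le_of_eq (congrArg 𝓝 ?_))
  -- Difference of Gaussian entropies: the constants `1` and `2 * π` and the variance of `X₁`
  -- cancel.
  rw [integral_log_edgeLik hσ₁ hσ₂, linearGaussian_map_fst, linearGaussian_map_snd,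
    integral_log_gaussianPDFReal _ (by simpa using hv₁.ne'),
    integral_log_gaussianPDFReal _ (by simpa using hv₂),
    Real.coe_toNNReal _ hv₁.le, Real.coe_toNNReal _ hv₂.le, Real.log_div hv₂.ne' (by positivity),
    Real.log_mul (x := 2 * Real.pi) (y := σ₂ ^ 2) (by positivity) (by positivity),
    Real.log_mul (x := 2 * Real.pi) (y := σ₂ ^ 2 + _) (by positivity) (by positivity)]
  ring

end

/-! ### Medians and the discretized data -/

/-- Reflection at `m` swaps the two half-lines, and their common point has no mass. -/
lemma gaussianReal_real_Ici_mean (m : ℝ) {v : ℝ≥0} (hv : v ≠ 0) :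
    (gaussianReal m v).real (Set.Ici m) = 1 / 2 ∧ (gaussianReal m v).real (Set.Iic m) = 1 / 2 := by
  have := nullSingletonClass_gaussianReal (μ := m) hv
  have h1 : (gaussianReal m v).real (Set.Ici m) = (gaussianReal m v).real (Set.Iic m) := by
    have h := gaussianReal_map_const_sub (μ := m) (v := v) (2 * m)
    rw [show 2 * m - m = m by ring] at h
    conv_lhs => rw [← h]
    rw [map_measureReal_apply (by fun_prop) measurableSet_Ici]
    congr 1
    ext x
    simp only [Set.mem_preimage, Set.mem_Ici, Set.mem_Iic]
    constructor <;> intro h <;> linarith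
  have h2 : (gaussianReal m v).real (Set.Ici m) + (gaussianReal m v).real (Set.Iio m) = 1 := by
    have := measureReal_add_measureReal_compl (μ := gaussianReal m v) (s := Set.Ici m)
      measurableSet_Ici
    rwa [Set.compl_Ici, probReal_univ] at this
  have h3 : (gaussianReal m v).real (Set.Iio m) = (gaussianReal m v).real (Set.Iic m) :=
    measureReal_congr Iio_ae_eq_Iic
  constructor <;> linarith

lemma gaussianReal_real_Ioo_pos (m : ℝ) {v : ℝ≥0} (hv : v ≠ 0) {a b : ℝ} (hab : a < b) :
    0 < (gaussianReal m v).real (Set.Ioo a b) := by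
  refine ENNReal.toReal_pos (fun h => ?_) (measure_ne_top _ _)
  have := gaussianReal_absolutelyContinuous' m hv h
  simp at this
  linarith

/-- The interval between `c` and `m` would have positive mass, leaving less than one half beyond
`c`. -/
lemma eq_mean_of_isMedian {m : ℝ} {v : ℝ≥0} (hv : v ≠ 0) {c : ℝ}
    (hc : IsMedian (gaussianReal m v) c) : c = m := by
  obtain ⟨h1, h2⟩ := hc
  obtain ⟨e1, e2⟩ := gaussianReal_real_Ici_mean m hv
  have toR : ∀ s, 1 / 2 ≤ gaussianReal m v s → 1 / 2 ≤ (gaussianReal m v).real s := fun s hs => by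
    have := ENNReal.toReal_mono (measure_ne_top _ _) hs
    simpa [Measure.real] using this
  rcases lt_trichotomy c m with h | h | h
  · have h3 : (gaussianReal m v).real (Set.Iic c) + (gaussianReal m v).real (Set.Ioo c m)
        ≤ (gaussianReal m v).real (Set.Iic m) := by
      rw [← measureReal_union _ measurableSet_Ioo]
      · refine measureReal_mono ?_
        rintro x (hx | hx)
        · exact le_trans hx h.le
        · exact hx.2.le
      · exact Set.disjoint_left.2 fun x hx hx' => absurd hx'.1 (not_lt.2 hx)
    have := gaussianReal_real_Ioo_pos m hv h
    linarith [toR _ h1]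
  · exact h
  · have h3 : (gaussianReal m v).real (Set.Ici c) + (gaussianReal m v).real (Set.Ioo m c)
        ≤ (gaussianReal m v).real (Set.Ici m) := by
      rw [← measureReal_union _ measurableSet_Ioo]
      · refine measureReal_mono ?_
        rintro x (hx | hx)
        · exact le_trans h.le hx
        · exact hx.1.le
      · exact Set.disjoint_left.2 fun x hx hx' => absurd hx'.2 (not_lt.2 hx)
    have := gaussianReal_real_Ioo_pos m hv h
    linarith [toR _ h2]

lemma gaussianReal_std_real_Ici_neg (r : ℝ) :
    (gaussianReal 0 1).real (Set.Ici (-r)) = cdf (gaussianReal 0 1) r := by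
  rw [cdf_eq_real]
  have h := gaussianReal_map_neg (μ := 0) (v := 1)
  rw [neg_zero] at h
  conv_lhs => rw [← h]
  rw [map_measureReal_apply (by fun_prop) measurableSet_Ici]
  congr 1
  ext x
  simp

section

variable {σ₁ σ₂ : ℝ} (hσ₁ : 0 < σ₁) (hσ₂ : 0 < σ₂) (μ₁ μ₂ β : ℝ)

lemma measurable_discretize (c₁ c₂ : ℝ) : Measurable (discretize c₁ c₂) := by
  refine Measurable.prodMk ?_ ?_
  · exact measurable_to_bool (by
      convert measurableSet_le (measurable_const (a := c₁)) (measurable_fst (α := ℝ) (β := ℝ))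
      ext x; simp)
  · exact measurable_to_bool (by
      convert measurableSet_le (measurable_const (a := c₂)) (measurable_snd (α := ℝ) (β := ℝ))
      ext x; simp)

include hσ₁ hσ₂

/-- In the noise coordinates the upper quadrant is a wedge in the half-plane `0 ≤ z.1`; its vertical
slices have standard normal mass `Φ (σ₁ * β * z.1 / σ₂)` by symmetry. -/
lemma discretize_real_true_true :
    ((linearGaussian μ₁ μ₂ β σ₁ σ₂).map (discretize μ₁ (μ₂ + β * μ₁))).real {(true, true)}
      = pTilde β σ₁ σ₂ := by
  have hS : MeasurableSet {z : ℝ × ℝ | 0 ≤ z.1 ∧ -(σ₁ * β * z.1 / σ₂) ≤ z.2} := by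
    rw [Set.ofPred_and]
    refine (measurableSet_le ?_ ?_).inter (measurableSet_le ?_ ?_) <;> fun_prop
  have h1 : pairOfStd μ₁ μ₂ β σ₁ σ₂ ⁻¹' (discretize μ₁ (μ₂ + β * μ₁) ⁻¹' {(true, true)})
      = {z : ℝ × ℝ | 0 ≤ z.1 ∧ -(σ₁ * β * z.1 / σ₂) ≤ z.2} := by
    ext z
    simp only [discretize, pairOfStd, Set.mem_preimage, Set.mem_singleton_iff, Prod.mk.injEq,
      decide_eq_true_eq, Set.mem_ofPred_eq]
    refine and_congr ?_ ?_
    · rw [le_add_iff_nonneg_right, mul_nonneg_iff_of_pos_left hσ₁]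
    · rw [← neg_div, div_le_iff₀ hσ₂]
      constructor <;> intro h <;> linarith
  rw [map_measureReal_apply (measurable_discretize _ _) (measurableSet_singleton _),
    linearGaussian_eq_map, map_measureReal_apply (measurable_pairOfStd _ _ _ _ _)
      (measurable_discretize _ _ (measurableSet_singleton _)), h1, Measure.real,
    Measure.prod_apply hS]
  have h2 : ∀ x : ℝ, gaussianReal 0 1
      (Prod.mk x ⁻¹' {z : ℝ × ℝ | 0 ≤ z.1 ∧ -(σ₁ * β * z.1 / σ₂) ≤ z.2})
      = ENNReal.ofReal ((Set.Ici 0).indicator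
          (fun x => cdf (gaussianReal 0 1) (σ₁ * β * x / σ₂)) x) := fun x => by
    by_cases hx : 0 ≤ x
    · rw [Set.indicator_of_mem (Set.mem_Ici.2 hx), ← gaussianReal_std_real_Ici_neg,
        ofReal_measureReal]
      congr 1
      ext y
      simp [hx]
    · rw [Set.indicator_of_notMem (by simpa using hx)]
      simp [hx]
  have hm : Measurable ((Set.Ici (0 : ℝ)).indicator
      (fun x => cdf (gaussianReal 0 1) (σ₁ * β * x / σ₂))) :=
    (((monotone_cdf _).measurable).comp (by fun_prop)).indicator measurableSet_Ici
  simp_rw [h2]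
  rw [← integral_eq_lintegral_of_nonneg_ae
    (Eventually.of_forall fun x => Set.indicator_nonneg (fun _ _ => cdf_nonneg _ _) _)
    hm.aestronglyMeasurable, integral_gaussianReal_eq_integral_smul one_ne_zero, pTilde,
    ← integral_Ici_eq_integral_Ioi, ← integral_indicator measurableSet_Ici]
  refine integral_congr_ae (Eventually.of_forall fun x => ?_)
  by_cases hx : x ∈ Set.Ici (0 : ℝ)
  · simp [Set.indicator_of_mem hx, gaussianPDFReal, neg_div]
  · simp [Set.indicator_of_notMem hx]

lemma linearGaussian_real_pos {s t : Set ℝ} (hs : IsOpen s) (ht : IsOpen t) (hs' : s.Nonempty)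
    (ht' : t.Nonempty) : 0 < (linearGaussian μ₁ μ₂ β σ₁ σ₂).real (s ×ˢ t) := by
  have hm : Measurable (edgeLik (![μ₁, μ₂ + β * μ₁], dataPrecision β σ₁ σ₂)) :=
    measurable_edgeLik.of_uncurry_left
  have hpos : ∀ x, 0 < edgeLik (![μ₁, μ₂ + β * μ₁], dataPrecision β σ₁ σ₂) x := fun x => by
    rw [edgeLik_dataPrecision hσ₁ hσ₂]
    exact mul_pos (gaussianPDFReal_pos _ _ _ (by simp; positivity))
      (gaussianPDFReal_pos _ _ _ (by simp; positivity))
  refine ENNReal.toReal_pos ?_ (measure_ne_top _ _)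
  rw [linearGaussian_eq_withDensity hσ₁ hσ₂, Ne, withDensity_apply_eq_zero hm.ennreal_ofReal]
  simp only [ne_eq, ENNReal.ofReal_eq_zero, not_le, hpos, Set.ofPred_true, Set.univ_inter]
  exact (hs.prod ht).measure_ne_zero volume (hs'.prod ht')

/-- The limit of the expected log posterior ratio per sample under the BDe score, for data
discretized at the medians. -/
theorem tendsto_expectedRatioBDe_linearGaussian {prior : Graph → ℝ} (hprior : ∀ G, 0 < prior G)
    {a : Fin 4 → ℝ} (ha : ∀ i, 0 < a i) {c₁ c₂ : ℝ}
    (hc₁ : IsMedian ((linearGaussian μ₁ μ₂ β σ₁ σ₂).map Prod.fst) c₁)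
    (hc₂ : IsMedian ((linearGaussian μ₁ μ₂ β σ₁ σ₂).map Prod.snd) c₂) :
    Tendsto (expectedRatioBDe prior a c₁ c₂ (linearGaussian μ₁ μ₂ β σ₁ σ₂)) atTop
      (𝓝 (Real.log 4 + 2 * pTilde β σ₁ σ₂ * Real.log (pTilde β σ₁ σ₂)
        + (1 - 2 * pTilde β σ₁ σ₂) * Real.log (1 / 2 - pTilde β σ₁ σ₂))) := by
  have hv₁ : (σ₁ ^ 2).toNNReal ≠ 0 := by simp; positivity
  have hv₂ : (σ₂ ^ 2 + β ^ 2 * σ₁ ^ 2).toNNReal ≠ 0 := by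
    rw [Ne, Real.toNNReal_eq_zero, not_le]; positivity
  rw [linearGaussian_map_fst] at hc₁
  rw [linearGaussian_map_snd] at hc₂
  obtain rfl := eq_mean_of_isMedian hv₁ hc₁
  obtain rfl := eq_mean_of_isMedian hv₂ hc₂
  have hd := measurable_discretize c₁ (μ₂ + β * c₁)
  have h11 := discretize_real_true_true hσ₁ hσ₂ c₁ μ₂ β
  set P := linearGaussian c₁ μ₂ β σ₁ σ₂ with hP
  have := Measure.isProbabilityMeasure_map (μ := P) hd.aemeasurable
  set Q := P.map (discretize c₁ (μ₂ + β * c₁)) with hQ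
  have f1 : Q.real {(true, true)} + Q.real {(true, false)} = 1 / 2 := by
    rw [← map_fst_true, ← (gaussianReal_real_Ici_mean c₁ hv₁).1,
      ← linearGaussian_map_fst c₁ μ₂ β σ₁ σ₂, hQ, Measure.map_map measurable_fst hd,
      map_measureReal_apply (measurable_fst.comp hd) (measurableSet_singleton _),
      map_measureReal_apply measurable_fst measurableSet_Ici]
    congr 1
    ext x
    simp [discretize]
  have f2 : Q.real {(true, true)} + Q.real {(false, true)} = 1 / 2 := by
    rw [← map_snd_true, ← (gaussianReal_real_Ici_mean (μ₂ + β * c₁) hv₂).1,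
      ← linearGaussian_map_snd c₁ μ₂ β σ₁ σ₂, hQ, Measure.map_map measurable_snd hd,
      map_measureReal_apply (measurable_snd.comp hd) (measurableSet_singleton _),
      map_measureReal_apply measurable_snd measurableSet_Ici]
    congr 1
    ext x
    simp [discretize]
  -- The data density is positive everywhere, so open quadrants have positive mass. With the fair
  -- margins this yields `0 < pTilde < 1 / 2`, which keeps all four cells positive.
  have p11 : 0 < Q.real {(true, true)} := by
    rw [hQ, map_measureReal_apply hd (measurableSet_singleton _)]
    refine lt_of_lt_of_le (linearGaussian_real_pos hσ₁ hσ₂ c₁ μ₂ β (isOpen_Ioi (a := c₁))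
      (isOpen_Ioi (a := μ₂ + β * c₁)) ⟨c₁ + 1, by simp⟩ ⟨μ₂ + β * c₁ + 1, by simp⟩)
      (measureReal_mono ?_)
    rintro x ⟨h1, h2⟩
    simp [discretize, (Set.mem_Ioi.1 h1).le, (Set.mem_Ioi.1 h2).le]
  have p10 : 0 < Q.real {(true, false)} := by
    rw [hQ, map_measureReal_apply hd (measurableSet_singleton _)]
    refine lt_of_lt_of_le (linearGaussian_real_pos hσ₁ hσ₂ c₁ μ₂ β (isOpen_Ioi (a := c₁))
      (isOpen_Iio (a := μ₂ + β * c₁)) ⟨c₁ + 1, by simp⟩ ⟨μ₂ + β * c₁ - 1, by simp⟩)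
      (measureReal_mono ?_)
    rintro x ⟨h1, h2⟩
    simpa [discretize, (Set.mem_Ioi.1 h1).le] using h2
  rw [h11] at f1 f2 p11
  exact tendsto_expectedRatioBDe hprior ha c₁ (μ₂ + β * c₁) P hd p11 (by linarith) h11
    (by linarith) (by linarith)

end

end TwoNodeBN

open TwoNodeBN in
theorem theorem1
    -- the data generating process
    (μ₁ μ₂ β σ₁ σ₂ : ℝ) (hσ₁ : 0 < σ₁) (hσ₂ : 0 < σ₂)
    -- the prior probabilities of the two graphs
    (prior : Graph → ℝ) (hprior : ∀ G, 0 < prior G) (hprior_sum : prior .indep + prior .edge = 1)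
    -- the hyperparameters of the Normal-Wishart prior
    (αμ αw t : ℝ) (hαμ : 0 < αμ) (hαw : 3 < αw) (ht : 0 < t)
    -- the hyperparameters of the Dirichlet prior
    (a : Fin 4 → ℝ) (ha : ∀ i, 0 < a i)
    -- the cutting points are medians of the two variables
    (c₁ c₂ : ℝ)
    (hc₁ : IsMedian ((linearGaussian μ₁ μ₂ β σ₁ σ₂).map Prod.fst) c₁)
    (hc₂ : IsMedian ((linearGaussian μ₁ μ₂ β σ₁ σ₂).map Prod.snd) c₂) :
    ((∀ N : ℕ, Integrable
        (fun x : Fin N → ℝ × ℝ => bgeLogRatio prior 0 (t • (1 : Matrix (Fin 2) (Fin 2) ℝ)) αμ αw x)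
        (sampleLaw (linearGaussian μ₁ μ₂ β σ₁ σ₂) N)) ∧
      Tendsto
        (expectedRatioBGe prior 0 (t • (1 : Matrix (Fin 2) (Fin 2) ℝ)) αμ αw
          (linearGaussian μ₁ μ₂ β σ₁ σ₂))
        atTop (𝓝 (1 / 2 * Real.log ((σ₂ ^ 2 + β ^ 2 * σ₁ ^ 2) / σ₂ ^ 2)))) ∧
    Tendsto (expectedRatioBDe prior a c₁ c₂ (linearGaussian μ₁ μ₂ β σ₁ σ₂)) atTop
      (𝓝 (Real.log 4 + 2 * pTilde β σ₁ σ₂ * Real.log (pTilde β σ₁ σ₂)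
        + (1 - 2 * pTilde β σ₁ σ₂) * Real.log (1 / 2 - pTilde β σ₁ σ₂))) := by
  exact ⟨tendsto_expectedRatioBGe hσ₁ hσ₂ μ₁ μ₂ β hprior hαμ hαw ht,
    tendsto_expectedRatioBDe_linearGaussian hσ₁ hσ₂ μ₁ μ₂ β hprior ha hc₁ hc₂⟩
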